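/- All graphs are finite and may have loops and multiple edges. An \emph{eulerian} graph is a connected graph all of whose vertices have even valency (a loop contributes $2$ to the valency). A \emph{signed graph} is a graph each of whose edges is positive or negative. The \emph{sign} of a circuit (a connected $2$-regular subgraph; a loop is a circuit) is the product of the signs of its edges; a signed graph is \emph{balanced} if it contains no circuit of sign $-1$, and \emph{unbalanced} otherwise. It is \emph{tightly unbalanced} if it is unbalanced and $G-e$ is balanced for some edge $e$. A signed eulerian graph is \emph{even} (\emph{odd}) if its number of negative edges is even (odd). It is \emph{triply odd} if its edge set can be decomposed into three pairwise edge-disjoint odd eulerian subgraphs that have a common vertex. An \emph{orientation} of a signed graph directs each of the two half-edges of every edge to or out of its end-vertex, so that for a positive edge exactly one of its two half-edges is directed out of its end-vertex, while for a negative edge both or none are. For an abelian group $A$, an \emph{$A$-flow} with respect to a given orientation is a map $\xi\colon E(G)\to A$ such that at every vertex $v$ the sum of the values over the half-edges directed out of $v$ equals the sum of the values over the half-edges directed to $v$; it is \emph{nowhere-zero} if $\xi(e)\neq 0$ for every edge $e$. (Every signed graph has an orientation, and whether a nowhere-zero $A$-flow exists does not depend on it; the theorem is asserted for every orientation.) \textbf{Theorem.}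 Let $G$ be a signed eulerian graph, endowed with an arbitrary orientation, and let $A$ be a nontrivial abelian group. \begin{itemize} \item[(a)] If $A$ contains an involution (an element of order $2$), then $G$ admits a nowhere-zero $A$-flow. \item[(b)] If $A\cong\mathbb{Z}_3$, then $G$ admits a nowhere-zero $A$-flow if and only if $G$ is even or triply odd. \item[(c)] Otherwise (that is, if $A$ contains no involution and $A\not\cong\mathbb{Z}_3$), $G$ admits a nowhere-zero $A$-flow if and only if $G$ is not tightly unbalanced. \end{itemize} -/

import Mathlib

open scoped Graph

namespace SignedGraph

/-! Graphs are multigraphs, Mathlib's `Graph α β`: loops and parallel edges are allowed, and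
subgraphs are again terms of `Graph α β`, ordered by `≤`. A signature is a map `σ : β → ℤˣ`;
only its values on the edges of the graph matter. -/

variable {α β : Type*}

/-- The valency of a vertex; a loop counts twice. -/
noncomputable def valency (G : Graph α β) (x : α) : ℕ :=
  (G.incidenceSet x).ncard + (G.loopSet x).ncard

/-- A graph is connected if it has a vertex and any two vertices are joined by a walk. -/
def IsConnected (G : Graph α β) : Prop :=
  V(G).Nonempty ∧ ∀ x ∈ V(G), ∀ y ∈ V(G), Relation.ReflTransGen G.Adj x y

/-- A graph is eulerian if it is connected and all its vertices have even valency. -/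
def IsEulerian (G : Graph α β) : Prop :=
  IsConnected G ∧ ∀ x ∈ V(G), Even (valency G x)

/-- A circuit is a connected 2-regular graph. -/
def IsCircuit (C : Graph α β) : Prop :=
  IsConnected C ∧ ∀ x ∈ V(C), valency C x = 2

/-- The sign of a (finite) signed graph: the product of the signs of its edges. -/
noncomputable def sign (G : Graph α β) (σ : β → ℤˣ) : ℤˣ := ∏ᶠ e ∈ E(G), σ e

/-- A signed graph is balanced if it contains no circuit of sign `-1`. -/
def IsBalanced (G : Graph α β) (σ : β → ℤˣ) : Prop :=
  ∀ C : Graph α β, C ≤ G → IsCircuit C → sign C σ = 1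

/-- A signed graph is tightly unbalanced if it is unbalanced, but deleting some edge makes it
balanced. -/
def IsTightlyUnbalanced (G : Graph α β) (σ : β → ℤˣ) : Prop :=
  ¬ IsBalanced G σ ∧ ∃ e ∈ E(G), IsBalanced (G.deleteEdges {e}) σ

/-- The number of negative edges of a (finite) signed graph. -/
noncomputable def numNegative (G : Graph α β) (σ : β → ℤˣ) : ℕ :=
  {e ∈ E(G) | σ e = -1}.ncard

/-- A signed graph is triply odd if it can be decomposed into three pairwise edge-disjoint
eulerian subgraphs, each with an odd number of negative edges, that share a common vertex. -/
def IsTriplyOdd (G : Graph α β) (σ : β → ℤˣ) : Prop :=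
  ∃ H : Fin 3 → Graph α β,
    (∀ i, H i ≤ G ∧ IsEulerian (H i) ∧ Odd (numNegative (H i) σ)) ∧
    (∀ i j, i ≠ j → Disjoint E(H i) E(H j)) ∧
    (⋃ i, E(H i)) = E(G) ∧
    ∃ v, ∀ i, v ∈ V(H i)

/-- An orientation of a signed graph. Every edge `e` consists of the two half-edges `(e, false)`
and `(e, true)`; `vert e b` is the end-vertex of `e` with which the half-edge `(e, b)` is incident,
and `out e b` tells whether this half-edge is directed out of (`true`) or to (`false`) that
end-vertex. The two half-edges of a positive edge are aligned (one is directed out of and the other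
one to its end-vertex); those of a negative edge are both directed out of or both directed to
their end-vertices. -/
structure Orientation (G : Graph α β) (σ : β → ℤˣ) where
  vert : E(G) → Bool → α
  out : E(G) → Bool → Bool
  isLink_vert : ∀ e : E(G), G.IsLink e (vert e false) (vert e true)
  compatible : ∀ e : E(G), out e false ≠ out e true ↔ σ e = 1

/-- The half-edges incident with `v` that are directed out of `v`. -/
def Orientation.outAt {G : Graph α β} {σ : β → ℤˣ} (D : Orientation G σ) (v : α) :
    Set (E(G) × Bool) :=
  {h | D.vert h.1 h.2 = v ∧ D.out h.1 h.2 = true}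

/-- The half-edges incident with `v` that are directed to `v`. -/
def Orientation.inAt {G : Graph α β} {σ : β → ℤˣ} (D : Orientation G σ) (v : α) :
    Set (E(G) × Bool) :=
  {h | D.vert h.1 h.2 = v ∧ D.out h.1 h.2 = false}

/-- `ξ` is a flow on the (finite) oriented signed graph: Kirchhoff's law holds at each vertex. -/
def Orientation.IsFlow {G : Graph α β} {σ : β → ℤˣ} (D : Orientation G σ)
    {A : Type*} [AddCommGroup A] (ξ : E(G) → A) : Prop :=
  ∀ v ∈ V(G), (∑ᶠ h ∈ D.outAt v, ξ h.1) - (∑ᶠ h ∈ D.inAt v, ξ h.1) = 0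

/-- The oriented signed graph has an `A`-flow without zero values. -/
def Orientation.HasNowhereZeroFlow {G : Graph α β} {σ : β → ℤˣ} (D : Orientation G σ)
    (A : Type*) [AddCommGroup A] : Prop :=
  ∃ ξ : E(G) → A, D.IsFlow ξ ∧ ∀ e, ξ e ≠ 0

/-- Every signed graph has an orientation. -/
theorem nonempty_orientation (G : Graph α β) (σ : β → ℤˣ) : Nonempty (Orientation G σ) := by
  classical
  have h : ∀ e : E(G), ∃ x y, G.IsLink e x y := fun e =>
    (G.edge_mem_iff_exists_isLink e).1 e.2
  choose x y hxy using h
  refine ⟨⟨fun e b => if b then y e else x e, fun e b => if b then decide (σ e ≠ 1) else true,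
    fun e => by simpa using hxy e, fun e => by simp⟩⟩

end SignedGraph

/-! Cut a closed eulerian trail at its base and send a value `a` along it, changing sign at each
negative edge. Kirchhoff's law then holds everywhere except perhaps at the base, where the defect is
`0` if the graph is even and `2a` if it is odd. So even graphs always have a flow with values `±a`.
If `2a = 0`, the constant `a` is a flow, since all valencies are even. If `3a = 0` and the graph is
triply odd, three odd trails through a common vertex give the defect `6a = 0` there.

The converse for `ZMod 3` is the hard part. Direct the edges so that all values are `1`; this gives
an `IsNet`. The main tool is a splitting-off theorem, `Tough.exists_red_root`: vertices outside a
root set can be eliminated by splitting off pairs of edges so that cuts keep size at least `2k` and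
every potential still leaves at least `m ≤ k` inconsistent edges. The choice of a pair rests on two
facts: tight cuts uncross, and the difference of two potentials is a cut with no more edges than the
two have inconsistent edges together. If all cuts of the net have at least 6 edges, take `k = m =
3`: an odd net has odd frustration, and frustration 1 contradicts Kirchhoff's law modulo 3, so
elimination down to one vertex leaves at least three odd loops, which are closed walks of the
original graph. A smallest cut of size 2 or 4 is removed by induction: one side is eliminated onto
the other, and this leaves just enough odd edges to form a smaller net (`IsNet.exists_smaller`). The
same splitting theorem with `k = 1`, `m = 0` yields the eulerian trails.

For groups without involutions, suppose that deleting `e` makes an unbalanced graph balanced. A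
suitable switching makes `e` the only negative edge, and summing Kirchhoff's law gives `2ξ(e) = 0`,
so there is no nowhere-zero flow. Conversely, let an odd graph not be tightly unbalanced, and
traverse an odd eulerian trail cyclically. Every position lies on an arc that is an even closed
subtrail; otherwise the parity along the trail would be a potential after deletion of that edge. An
irredundant cover by such arcs meets each position at most twice. One arc gets the value `b`, the
others get `±a` with matching signs, and the resulting values `±a`, `±2a`, `±b`, `±b ± a` are
nonzero when `b ≠ 0, ±a`. -/

namespace SignedGraph

variable {α β : Type*}

/-! ### Multisets of signed edges -/

/-- The number of edges whose ends get different values. -/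
def cut (M : Multiset (α × α × ZMod 2)) (f : α → ZMod 2) : ℕ :=
  (M.map fun e => (f e.1 + f e.2.1).val).sum

/-- The number of edges that are inconsistent with the potential `f`. -/
def frus (M : Multiset (α × α × ZMod 2)) (f : α → ZMod 2) : ℕ :=
  (M.map fun e => (e.2.2 + f e.1 + f e.2.1).val).sum

/-- The number of ends in a set. -/
noncomputable def endsIn (Y : Set α) (M : Multiset (α × α × ZMod 2)) : ℕ :=
  (M.map fun e => Y.indicator 1 e.1 + Y.indicator 1 e.2.1).sum

/-- Splitting off at vertices outside `Y`, and reversal of edges. -/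
inductive Step (Y : Set α) : Multiset (α × α × ZMod 2) → Multiset (α × α × ZMod 2) → Prop
  | flip (x y : α) (s : ZMod 2) (R) : Step Y ((x, y, s) ::ₘ R) ((y, x, s) ::ₘ R)
  | join (x u y : α) (s t : ZMod 2) (R) (hu : u ∉ Y) :
      Step Y ((x, u, s) ::ₘ (u, y, t) ::ₘ R) ((x, y, s + t) ::ₘ R)

/-- Repeated splitting off. -/
def Red (Y : Set α) := Relation.ReflTransGen (Step Y)

lemma Step.add_right {Y : Set α} {M M' : Multiset (α × α × ZMod 2)} (h : Step Y M M')
    (K : Multiset (α × α × ZMod 2)) : Step Y (M + K) (M' + K) := by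
  cases h with
  | flip x y s R => simpa using Step.flip x y s (R + K)
  | join x u y s t R hu => simpa using Step.join x u y s t (R + K) hu

lemma Red.add_right {Y : Set α} {M M' : Multiset (α × α × ZMod 2)} (h : Red Y M M')
    (K : Multiset (α × α × ZMod 2)) : Red Y (M + K) (M' + K) := by
  induction h with
  | refl => exact .refl
  | tail _ h ih => exact .tail ih (h.add_right K)

lemma Red.cons {Y : Set α} {M M' : Multiset (α × α × ZMod 2)} (h : Red Y M M')
    (e : α × α × ZMod 2) : Red Y (e ::ₘ M) (e ::ₘ M') := by
  simpa [Multiset.add_comm _ {e}] using h.add_right {e}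

lemma Step.endsIn_eq {Y : Set α} {M M' : Multiset (α × α × ZMod 2)} (h : Step Y M M') :
    endsIn Y M = endsIn Y M' := by
  cases h with
  | flip x y s R => simp [endsIn]; ring
  | join x u y s t R hu => simp [endsIn, hu]; ring

lemma Step.cut_eq {Y : Set α} {M M' : Multiset (α × α × ZMod 2)} (h : Step Y M M')
    (f : α → ZMod 2) : (cut M f : ZMod 2) = cut M' f := by
  have h2 : ∀ a b c : ZMod 2, a + b + (b + c) = a + c := by decide
  cases h with
  | flip x y s R => simp [cut, add_comm]
  | join x u y s t R hu => simp [cut, ← add_assoc, ← h2 (f x) (f u) (f y)]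

lemma Red.cut_eq {Y : Set α} {M M' : Multiset (α × α × ZMod 2)} (h : Red Y M M')
    (f : α → ZMod 2) : (cut M f : ZMod 2) = cut M' f := by
  induction h with
  | refl => rfl
  | tail _ h ih => exact ih.trans (h.cut_eq f)

lemma Red.endsIn_eq {Y : Set α} {M M' : Multiset (α × α × ZMod 2)} (h : Red Y M M') :
    endsIn Y M = endsIn Y M' := by
  induction h with
  | refl => rfl
  | tail _ h ih => exact ih.trans h.endsIn_eq

/-- The values of `f` differ somewhere on `V`. -/
def Sep (V : Set α) (f : α → ZMod 2) : Prop := ∃ x ∈ V, ∃ y ∈ V, f x ≠ f y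

/-- The function `f` is constant on `Y`. -/
def ConstOn (Y : Set α) (f : α → ZMod 2) : Prop := ∀ x ∈ Y, ∀ y ∈ Y, f x = f y

lemma cut_cons (e) (M : Multiset (α × α × ZMod 2)) (f : α → ZMod 2) :
    cut (e ::ₘ M) f = (f e.1 + f e.2.1).val + cut M f := by simp [cut]

lemma frus_cons (e) (M : Multiset (α × α × ZMod 2)) (f : α → ZMod 2) :
    frus (e ::ₘ M) f = (e.2.2 + f e.1 + f e.2.1).val + frus M f := by simp [frus]

lemma zmod2_cases (a : ZMod 2) : a = 0 ∨ a = 1 := by revert a; decide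

lemma zmod2_ne_zero {a : ZMod 2} (h : a ≠ 0) : a = 1 := (zmod2_cases a).resolve_left h

lemma zmod2_ne_one {a : ZMod 2} (h : a ≠ 1) : a = 0 := (zmod2_cases a).resolve_right h

lemma zmod2_ne {a b : ZMod 2} (h : a ≠ b) : a + b = 1 := by revert a b; decide

lemma sum_map_le_of_le {ι : Type*} (M : Multiset ι) (F F' : ι → ℕ) (h : ∀ e ∈ M, F e ≤ F' e) :
    (M.map F).sum ≤ (M.map F').sum := Multiset.sum_map_le_sum_map _ _ h

lemma cut_compl (M : Multiset (α × α × ZMod 2)) (f : α → ZMod 2) : cut M (f + 1) = cut M f := by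
  have h : ∀ a b : ZMod 2, a + 1 + (b + 1) = a + b := by decide
  simp [cut, h]

lemma frus_compl (M : Multiset (α × α × ZMod 2)) (f : α → ZMod 2) : frus M (f + 1) = frus M f := by
  have h : ∀ s a b : ZMod 2, s + (a + 1) + (b + 1) = s + a + b := by decide
  simp [frus, h]

/-- Submodularity of cuts: for functions read as sets, `f * g` is the intersection and `f + g + f *
g` the union. It is checked edge by edge. -/
lemma cut_or_add_cut_and_le (M : Multiset (α × α × ZMod 2)) (f g : α → ZMod 2) :
    cut M (f + g + f * g) + cut M (f * g) ≤ cut M f + cut M g := by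
  have h : ∀ a b a' b' : ZMod 2, (a + b + a * b + (a' + b' + a' * b')).val + (a * b + a' * b').val
    ≤ (a + a').val + (b + b').val := by decide
  simp only [cut, ← Multiset.sum_map_add]
  exact sum_map_le_of_le _ _ _ fun e _ => h _ _ _ _

/-- An edge across the difference of two potentials is inconsistent with exactly one of them. This
ties frustration to cuts. -/
lemma cut_add_le_frus (M : Multiset (α × α × ZMod 2)) (f g : α → ZMod 2) :
    cut M (f + g) ≤ frus M f + frus M g := by
  have h : ∀ a b a' b' s : ZMod 2, (a + b + (a' + b')).val
    ≤ (s + a + a').val + (s + b + b').val := by decide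
  simp only [cut, frus, ← Multiset.sum_map_add]
  exact sum_map_le_of_le _ _ _ fun e _ => h _ _ _ _ _

lemma cut_congr {M : Multiset (α × α × ZMod 2)} {f g : α → ZMod 2} {V : Set α}
    (hM : ∀ e ∈ M, e.1 ∈ V ∧ e.2.1 ∈ V) (h : ∀ x ∈ V, f x = g x) : cut M f = cut M g := by
  unfold cut
  congr 1
  exact Multiset.map_congr rfl fun e he => by rw [h _ (hM e he).1, h _ (hM e he).2]

lemma frus_congr {M : Multiset (α × α × ZMod 2)} {f g : α → ZMod 2} {V : Set α}
    (hM : ∀ e ∈ M, e.1 ∈ V ∧ e.2.1 ∈ V) (h : ∀ x ∈ V, f x = g x) : frus M f = frus M g := by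
  unfold frus
  congr 1
  exact Multiset.map_congr rfl fun e he => by rw [h _ (hM e he).1, h _ (hM e he).2]

/-! ### The edges at a vertex -/

/-- The number of spokes whose far end has value `1`. -/
def farOnes (l : Multiset (α × ZMod 2)) (f : α → ZMod 2) : ℕ := (l.map fun p => (f p.1).val).sum

/-- The number of spokes whose label is `1`. -/
def labelOnes (l : Multiset (α × ZMod 2)) (f : α → ZMod 2) : ℕ :=
  (l.map fun p => (p.2 + f p.1).val).sum

lemma farOnes_cons (p) (l : Multiset (α × ZMod 2)) (f : α → ZMod 2) :
    farOnes (p ::ₘ l) f = (f p.1).val + farOnes l f := by simp [farOnes]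

lemma labelOnes_cons (p) (l : Multiset (α × ZMod 2)) (f : α → ZMod 2) :
    labelOnes (p ::ₘ l) f = (p.2 + f p.1).val + labelOnes l f := by simp [labelOnes]

lemma farOnes_compl (l : Multiset (α × ZMod 2)) (f : α → ZMod 2) :
    farOnes l f + farOnes l (f + 1) = l.card := by
  have h : ∀ a : ZMod 2, a.val + (a + 1).val = 1 := by decide
  simp [farOnes, ← Multiset.sum_map_add, h]

lemma labelOnes_compl (l : Multiset (α × ZMod 2)) (f : α → ZMod 2) :
    labelOnes l f + labelOnes l (f + 1) = l.card := by
  have h : ∀ s a : ZMod 2, (s + a).val + (s + (a + 1)).val = 1 := by decide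
  simp [labelOnes, ← Multiset.sum_map_add, h]

lemma farOnes_or_add_and (l : Multiset (α × ZMod 2)) (f g : α → ZMod 2) :
    farOnes l (f + g + f * g) + farOnes l (f * g) = farOnes l f + farOnes l g := by
  have h : ∀ a b : ZMod 2, (a + b + a * b).val + (a * b).val = a.val + b.val := by decide
  simp [farOnes, ← Multiset.sum_map_add, h]

lemma farOnes_add_le (l : Multiset (α × ZMod 2)) (f g : α → ZMod 2) :
    farOnes l (f + g) ≤ labelOnes l f + labelOnes l g := by
  have h : ∀ s a b : ZMod 2, (a + b).val ≤ (s + a).val + (s + b).val := by decide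
  simp only [farOnes, labelOnes, ← Multiset.sum_map_add]
  exact sum_map_le_of_le _ _ _ fun e _ => h _ _ _

lemma farOnes_le_card (l : Multiset (α × ZMod 2)) (f : α → ZMod 2) : farOnes l f ≤ l.card := by
  have := farOnes_compl l f; omega

/-- The state in the elimination of a vertex `u`: the edges `R` avoiding `u`, the spokes `l` at `u`
and the number `Q` of odd loops at `u`. -/
structure SpokeState (Y V : Set α) (k m : ℕ) (R : Multiset (α × α × ZMod 2))
    (l : Multiset (α × ZMod 2)) (Q : ℕ) : Prop where
  ends : ∀ e ∈ R, e.1 ∈ V ∧ e.2.1 ∈ V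
  spokes : ∀ p ∈ l, p.1 ∈ V
  le_cut : ∀ f, ConstOn Y f → Sep V f → 2 * k ≤ cut R f + farOnes l f
  le_frus : ∀ f, ConstOn Y f → m ≤ frus R f + labelOnes l f + Q
  even_cut : ∀ f, ConstOn Y f → Even (cut R f + farOnes l f)
  even_frus : ∀ f, ConstOn Y f → Even (frus R f + labelOnes l f + Q + m)

lemma ConstOn.add {Y : Set α} {f g : α → ZMod 2} (hf : ConstOn Y f) (hg : ConstOn Y g) :
    ConstOn Y (f + g) := fun x hx y hy => by simp [hf x hx y hy, hg x hx y hy]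

lemma ConstOn.mul {Y : Set α} {f g : α → ZMod 2} (hf : ConstOn Y f) (hg : ConstOn Y g) :
    ConstOn Y (f * g) := fun x hx y hy => by simp [hf x hx y hy, hg x hx y hy]

lemma constOn_one {Y : Set α} : ConstOn Y (1 : α → ZMod 2) := fun _ _ _ _ => rfl

lemma Sep.compl {V : Set α} {f : α → ZMod 2} (hf : Sep V f) : Sep V (f + 1) := by
  obtain ⟨x, hx, y, hy, h⟩ := hf
  exact ⟨x, hx, y, hy, by simpa using h⟩

/-- Passing to `f + 1` moves `u` to the other side of the cut. This must not make a tight cut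
smaller, so at most half of the spokes cross it. -/
lemma SpokeState.two_mul_farOnes_le {Y V : Set α} {k m : ℕ} {R : Multiset (α × α × ZMod 2)}
    {l : Multiset (α × ZMod 2)} {Q : ℕ} (h : SpokeState Y V k m R l Q) {f : α → ZMod 2}
    (hf : ConstOn Y f) (hs : Sep V f) (ht : cut R f + farOnes l f = 2 * k) :
    2 * farOnes l f ≤ l.card := by
  have h1 := h.le_cut _ (hf.add constOn_one) hs.compl
  rw [cut_compl] at h1
  have := farOnes_compl l f
  omega

lemma SpokeState.two_mul_labelOnes_le {Y V : Set α} {k m : ℕ} {R : Multiset (α × α × ZMod 2)}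
    {l : Multiset (α × ZMod 2)} {Q : ℕ} (h : SpokeState Y V k m R l Q) {f : α → ZMod 2}
    (hf : ConstOn Y f) (ht : frus R f + labelOnes l f + Q = m) :
    2 * labelOnes l f ≤ l.card := by
  have h1 := h.le_frus _ (hf.add constOn_one)
  rw [frus_compl] at h1
  have := labelOnes_compl l f
  omega

lemma le_farOnes {l : Multiset (α × ZMod 2)} {p : α × ZMod 2} (hp : p ∈ l) {f : α → ZMod 2}
    (h : f p.1 = 1) : 1 ≤ farOnes l f := by
  obtain ⟨l', rfl⟩ := Multiset.exists_cons_of_mem hp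
  rw [farOnes_cons, h]
  exact Nat.le_add_right 1 _

/-- Splitting off `i` with `j` is fatal only if a tight cut has both far ends on the side away from
`u`. Among the tight cuts with `f i.1 = 1`, take one crossed by the most spokes. Uncrossing shows
that it captures every fatal `j`, and it captures fewer than half of the other spokes. -/
lemma SpokeState.exists_cut_guard {Y V : Set α} {k m : ℕ} {R : Multiset (α × α × ZMod 2)}
    {i : α × ZMod 2} {l : Multiset (α × ZMod 2)} {Q : ℕ} (h : SpokeState Y V k m R (i ::ₘ l) Q) :
    ∃ w : α × ZMod 2 → ZMod 2, 2 * (l.map fun p => (w p).val).sum + 1 ≤ l.card ∧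
      ∀ j ∈ l, w j = 0 → ∀ f, ConstOn Y f → Sep V f → f i.1 = 1 → f j.1 = 1 →
        cut R f + farOnes (i ::ₘ l) f ≠ 2 * k := by
  classical
  have hcard : Even (l.card + 1) := by
    have := h.even_cut 1 constOn_one
    have h0 : cut R 1 = 0 := by
      have : ((1 : ZMod 2) + 1).val = 0 := by decide
      simp [cut, this]
    have h1 : farOnes (i ::ₘ l) 1 = l.card + 1 := by
      have : (1 : ZMod 2).val = 1 := by decide
      simp [farOnes, this, add_comm]
    rwa [h0, h1, zero_add] at this
  let P : ℕ → Prop := fun n => ∃ f, ConstOn Y f ∧ Sep V f ∧ f i.1 = 1 ∧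
    cut R f + farOnes (i ::ₘ l) f = 2 * k ∧ farOnes (i ::ₘ l) f = n
  by_cases hP : ∃ n, P n
  · obtain ⟨n, hn⟩ := hP
    have hb : ∀ n, P n → n ≤ 2 * k := by rintro n ⟨f, -, -, -, h1, h2⟩; omega
    have hN := Nat.findGreatest_spec (hb n hn) hn
    obtain ⟨f₁, hf₁, hs₁, hi₁, ht₁, hn₁⟩ := hN
    have hmax : ∀ n, P n → n ≤ farOnes (i ::ₘ l) f₁ := fun n hn => by
      rw [hn₁]; exact Nat.le_findGreatest (hb n hn) hn
    refine ⟨fun p => f₁ p.1, ?_, ?_⟩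
    · have h1 := h.two_mul_farOnes_le hf₁ hs₁ ht₁
      rw [farOnes_cons, hi₁, Multiset.card_cons] at h1
      have : (1 : ZMod 2).val = 1 := by decide
      rw [this] at h1
      change 2 * farOnes l f₁ + 1 ≤ _
      omega
    · intro j hj hw f hf hs hi hfj ht
      have hiV := h.spokes i (Multiset.mem_cons_self _ _)
      have hjV := h.spokes j (Multiset.mem_cons_of_mem hj)
      have hand : ConstOn Y (f * f₁) := hf.mul hf₁
      have hor : ConstOn Y (f + f₁ + f * f₁) := (hf.add hf₁).add hand
      have hsand : Sep V (f * f₁) := ⟨i.1, hiV, j.1, hjV, by simp [hi, hi₁, hw]⟩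
      have e1 := cut_or_add_cut_and_le R f f₁
      have e2 := farOnes_or_add_and (i ::ₘ l) f f₁
      have e3 := h.le_cut _ hand hsand
      have hor1 : (f + f₁ + f * f₁) i.1 = 1 := by simp [hi, hi₁]; decide
      -- The union is not all of `V`: each tight cut captures at most half of the spokes, and both
      -- capture `i`, so together they miss a spoke.
      have hsor : Sep V (f + f₁ + f * f₁) := by
        by_contra hns
        have hall : ∀ x ∈ V, (f + f₁ + f * f₁) x = 1 := by
          intro x hx
          by_contra hne
          exact hns ⟨i.1, hiV, x, hx, by rw [hor1]; exact fun h => hne h.symm⟩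
        have hA : farOnes (i ::ₘ l) (f + f₁ + f * f₁) = (i ::ₘ l).card := by
          unfold farOnes
          rw [Multiset.map_congr rfl (g := fun _ => 1), Multiset.map_const', Multiset.sum_replicate]
          · simp
          · intro p hp
            rw [hall _ (h.spokes p hp)]; decide
        have e4 := h.two_mul_farOnes_le hf hs ht
        have e5 := h.two_mul_farOnes_le hf₁ hs₁ ht₁
        have e6 : 1 ≤ farOnes (i ::ₘ l) (f * f₁) :=
          le_farOnes (Multiset.mem_cons_self _ _) (by simp [hi, hi₁])
        omega
      have e4 := h.le_cut _ hor hsor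
      have e5 := hmax _ ⟨_, hor, hsor, hor1, by omega, rfl⟩
      have e6 : farOnes (i ::ₘ l) f₁ < farOnes (i ::ₘ l) (f + f₁ + f * f₁) := by
        obtain ⟨l', hl⟩ := Multiset.exists_cons_of_mem hj
        have hw' : f₁ j.1 = 0 := hw
        have hor2 : (f + f₁ + f * f₁) j.1 = 1 := by
          change f j.1 + f₁ j.1 + f j.1 * f₁ j.1 = 1
          rw [hfj, hw']; decide
        have h01 : (0 : ZMod 2).val = 0 := by decide
        have h11 : (1 : ZMod 2).val = 1 := by decide
        have hle : farOnes l' f₁ ≤ farOnes l' (f + f₁ + f * f₁) :=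
          sum_map_le_of_le _ _ _ fun p _ => by
            have : ∀ a b : ZMod 2, b.val ≤ (a + b + a * b).val := by decide
            exact this _ _
        rw [farOnes_cons, farOnes_cons, hl, farOnes_cons, farOnes_cons, hor1, hor2, hi₁, hw', h01,
          h11]
        omega
      omega
  · push Not at hP
    -- No tight cut passes through `i`, so nothing needs to be marked. The number of spokes
    -- including `i` is even, so `l` is nonempty.
    refine ⟨0, ?_, ?_⟩
    · have h0 : l.card ≠ 0 := fun h0 => by simp [h0] at hcard
      simpa using Nat.one_le_iff_ne_zero.2 h0
    · intro j hj _ f hf hs hi hfj ht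
      exact hP _ ⟨f, hf, hs, hi, ht, rfl⟩


lemma SpokeState.even_card {Y V : Set α} {k m : ℕ} {R : Multiset (α × α × ZMod 2)}
    {l : Multiset (α × ZMod 2)} {Q : ℕ} (h : SpokeState Y V k m R l Q) : Even l.card := by
  have := h.even_cut 1 constOn_one
  have h0 : cut R 1 = 0 := by
    have : ((1 : ZMod 2) + 1).val = 0 := by decide
    simp [cut, this]
  have h1 : farOnes l 1 = l.card := by
    have : (1 : ZMod 2).val = 1 := by decide
    simp [farOnes, this]
  rwa [h0, h1, zero_add] at this

/-- Here a fatal `j` comes from a tight potential under which `i` and `j` are both inconsistent. If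
another tight potential `f₂` made `i` but not `j` inconsistent, then `f + f₂` would be a separating
cut. Spoke `i` counts for both potentials but not for the cut, so the cut would have at most `2m - 2
< 2k` edges. -/
lemma SpokeState.exists_frus_guard {Y V : Set α} {k m : ℕ} (hmk : m ≤ k)
    {R : Multiset (α × α × ZMod 2)} {i : α × ZMod 2} {l : Multiset (α × ZMod 2)} {Q : ℕ}
    (h : SpokeState Y V k m R (i ::ₘ l) Q) :
    ∃ w : α × ZMod 2 → ZMod 2, 2 * (l.map fun p => (w p).val).sum + 1 ≤ l.card ∧
      ∀ j ∈ l, w j = 0 → ∀ f, ConstOn Y f → i.2 + f i.1 = 1 → j.2 + f j.1 = 1 →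
        frus R f + labelOnes (i ::ₘ l) f + Q ≠ m := by
  have h11 : (1 : ZMod 2).val = 1 := by decide
  by_cases hP : ∃ f, ConstOn Y f ∧ i.2 + f i.1 = 1 ∧ frus R f + labelOnes (i ::ₘ l) f + Q = m
  · obtain ⟨f₂, hf₂, hi₂, ht₂⟩ := hP
    refine ⟨fun p => p.2 + f₂ p.1, ?_, ?_⟩
    · have h1 := h.two_mul_labelOnes_le hf₂ ht₂
      rw [labelOnes_cons, hi₂, Multiset.card_cons, h11] at h1
      change 2 * labelOnes l f₂ + 1 ≤ _
      omega
    · intro j hj hw f hf hi hfj ht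
      have hx : ∀ s a b : ZMod 2, s + a = 1 → s + b = 1 → a + b = 0 := by decide
      have hy : ∀ s a b : ZMod 2, s + a = 1 → s + b = 0 → a + b = 1 := by decide
      have hi0 : (f + f₂) i.1 = 0 := hx _ _ _ hi hi₂
      have hs : Sep V (f + f₂) := by
        refine ⟨i.1, h.spokes i (Multiset.mem_cons_self _ _), j.1,
          h.spokes j (Multiset.mem_cons_of_mem hj), ?_⟩
        rw [hi0, show (f + f₂) j.1 = 1 from hy _ _ _ hfj hw]
        decide
      have e1 := h.le_cut _ (hf.add hf₂) hs
      have e2 := cut_add_le_frus R f f₂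
      have e3 := farOnes_add_le l f f₂
      have h00 : (0 : ZMod 2).val = 0 := by decide
      rw [farOnes_cons, hi0, h00] at e1
      rw [labelOnes_cons, hi, h11] at ht
      rw [labelOnes_cons, hi₂, h11] at ht₂
      omega
  · push Not at hP
    refine ⟨0, ?_, fun j hj _ f hf hi hfj ht => hP f hf hi ht⟩
    have h0 : l.card ≠ 0 := fun h0 => by
      have := h.even_card
      simp [h0] at this
    simpa using Nat.one_le_iff_ne_zero.2 h0

/-- A pair of spokes can be split off. -/
lemma SpokeState.exists_split {Y V : Set α} {k m : ℕ} (hmk : m ≤ k)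
    {R : Multiset (α × α × ZMod 2)} {i : α × ZMod 2} {l : Multiset (α × ZMod 2)} {Q : ℕ}
    (h : SpokeState Y V k m R (i ::ₘ l) Q) :
    ∃ j l', l = j ::ₘ l' ∧ SpokeState Y V k m ((i.1, j.1, i.2 + j.2) ::ₘ R) l' Q := by
  obtain ⟨w₁, hw₁, hg₁⟩ := h.exists_cut_guard
  obtain ⟨w₂, hw₂, hg₂⟩ := h.exists_frus_guard hmk
  -- Each guard marks fewer than half of the spokes in `l`, so some spoke is marked by neither.
  have hj : ∃ j ∈ l, w₁ j = 0 ∧ w₂ j = 0 := by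
    by_contra hno
    push Not at hno
    have h1 : (l.map fun _ => 1).sum ≤ (l.map fun p => (w₁ p).val + (w₂ p).val).sum := by
      refine sum_map_le_of_le _ _ _ fun p hp => ?_
      rcases zmod2_cases (w₁ p) with h0 | h0
      · have := zmod2_ne_zero (hno p hp h0)
        rw [h0, this]; decide
      · rw [h0]; exact Nat.le_add_right 1 _
    rw [Multiset.sum_map_add] at h1
    simp only [Multiset.map_const', Multiset.sum_replicate, smul_eq_mul, mul_one] at h1
    omega
  obtain ⟨j, hjl, hj₁, hj₂⟩ := hj
  obtain ⟨l', rfl⟩ := Multiset.exists_cons_of_mem hjl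
  have hiV := h.spokes i (Multiset.mem_cons_self _ _)
  have hjV := h.spokes j (Multiset.mem_cons_of_mem hjl)
  -- Splitting off lowers the cut by `0` or `2`. By parity, only a tight cut can fall below `2k`;
  -- the same applies to frustration.
  have hcut : ∀ f : α → ZMod 2, cut ((i.1, j.1, i.2 + j.2) ::ₘ R) f + farOnes l' f
      + 2 * (f i.1 * f j.1).val = cut R f + farOnes (i ::ₘ j ::ₘ l') f := by
    intro f
    have : ∀ a b : ZMod 2, (a + b).val + 2 * (a * b).val = a.val + b.val := by decide
    have := this (f i.1) (f j.1)
    rw [cut_cons, farOnes_cons, farOnes_cons]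
    dsimp only
    omega
  have hfrus : ∀ f : α → ZMod 2, frus ((i.1, j.1, i.2 + j.2) ::ₘ R) f + labelOnes l' f
      + 2 * ((i.2 + f i.1) * (j.2 + f j.1)).val = frus R f + labelOnes (i ::ₘ j ::ₘ l') f := by
    intro f
    have : ∀ s t a b : ZMod 2, (s + t + a + b).val + 2 * ((s + a) * (t + b)).val
      = (s + a).val + (t + b).val := by decide
    have := this i.2 j.2 (f i.1) (f j.1)
    rw [frus_cons, labelOnes_cons, labelOnes_cons]
    dsimp only
    omega
  have hval : ∀ a b : ZMod 2, (a * b).val = 0 ∨ (a * b).val = 1 ∧ a = 1 ∧ b = 1 := by decide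
  refine ⟨j, l', rfl, ⟨?_, ?_, ?_, ?_, ?_, ?_⟩⟩
  · intro e he
    rcases Multiset.mem_cons.1 he with rfl | he
    · exact ⟨hiV, hjV⟩
    · exact h.ends e he
  · exact fun p hp => h.spokes p (by simp [hp])
  · intro f hf hs
    have e1 := hcut f
    have e2 := h.le_cut f hf hs
    obtain ⟨c, hc⟩ := h.even_cut f hf
    rcases hval (f i.1) (f j.1) with h0 | ⟨h0, hi, hj⟩
    · omega
    · have := hg₁ j hjl hj₁ f hf hs hi hj
      omega
  · intro f hf
    have e1 := hfrus f
    have e2 := h.le_frus f hf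
    obtain ⟨c, hc⟩ := h.even_frus f hf
    rcases hval (i.2 + f i.1) (j.2 + f j.1) with h0 | ⟨h0, hi, hj⟩
    · omega
    · have := hg₂ j hjl hj₂ f hf hi hj
      omega
  · intro f hf
    have e1 := hcut f
    obtain ⟨c, hc⟩ := h.even_cut f hf
    exact ⟨c - (f i.1 * f j.1).val, by omega⟩
  · intro f hf
    have e1 := hfrus f
    obtain ⟨c, hc⟩ := h.even_frus f hf
    exact ⟨c - ((i.2 + f i.1) * (j.2 + f j.1)).val, by omega⟩

/-- An odd loop can be absorbed by a spoke. -/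
lemma SpokeState.exists_absorb {Y V : Set α} {k m : ℕ} (hk : 1 ≤ k) (hmk : m ≤ k)
    {R : Multiset (α × α × ZMod 2)} {l : Multiset (α × ZMod 2)} {Q : ℕ} (hl : 2 * k ≤ l.card)
    (h : SpokeState Y V k m R l (Q + 1)) :
    ∃ j l', l = j ::ₘ l' ∧ SpokeState Y V k m R ((j.1, j.2 + 1) ::ₘ l') Q := by
  -- Absorbing an odd loop into `j` lowers frustration, by `2`, exactly when `j` is inconsistent. So
  -- `j` must be consistent with all tight potentials.
  have hj : ∃ j ∈ l, ∀ f, ConstOn Y f → j.2 + f j.1 = 1 →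
      frus R f + labelOnes l f + (Q + 1) ≠ m := by
    by_cases hP : ∃ f, ConstOn Y f ∧ frus R f + labelOnes l f + (Q + 1) = m
    · obtain ⟨f₂, hf₂, ht₂⟩ := hP
      have h2 := h.two_mul_labelOnes_le hf₂ ht₂
      have hj : ∃ j ∈ l, j.2 + f₂ j.1 = 0 := by
        by_contra hno
        push Not at hno
        have : labelOnes l f₂ = l.card := by
          unfold labelOnes
          rw [Multiset.map_congr rfl (g := fun _ => 1), Multiset.map_const', Multiset.sum_replicate]
          · simp
          · intro p hp
            rw [zmod2_ne_zero (hno p hp)]; decide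
        omega
      obtain ⟨j, hjl, hj2⟩ := hj
      refine ⟨j, hjl, fun f hf hfj ht => ?_⟩
      have e2 := cut_add_le_frus R f f₂
      have e3 := farOnes_add_le l f f₂
      by_cases hs : Sep V (f + f₂)
      · have := h.le_cut _ (hf.add hf₂) hs
        omega
      -- If `f + f₂` does not separate `V`, then `f` is the complement of `f₂` there. As both are
      -- tight, each makes half of the spokes inconsistent, which is at least `k ≥ m` of them; the
      -- loop then brings the total above `m`.
      · have hy : ∀ s a b : ZMod 2, s + a = 1 → s + b = 0 → a + b = 1 := by decide
        have hall : ∀ x ∈ V, f x = (f₂ + 1) x := by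
          intro x hx
          have h1 : (f + f₂) j.1 = 1 := hy _ _ _ hfj hj2
          have h2 : f x + f₂ x = 1 := by
            by_contra hne
            exact hs ⟨j.1, h.spokes j hjl, x, hx, fun h => hne (by rw [← h1]; exact h.symm)⟩
          have : ∀ a b : ZMod 2, a + b = 1 → a = b + 1 := by decide
          exact this _ _ h2
        have h3 : frus R f = frus R f₂ := by
          rw [frus_congr h.ends hall, frus_compl]
        have h4 : labelOnes l f = labelOnes l (f₂ + 1) := by
          unfold labelOnes
          congr 1
          exact Multiset.map_congr rfl fun p hp => by rw [hall _ (h.spokes p hp)]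
        have h5 := labelOnes_compl l f₂
        omega
    · push Not at hP
      have : l ≠ 0 := by rintro rfl; simp at hl; omega
      obtain ⟨j, hj⟩ := Multiset.exists_mem_of_ne_zero this
      exact ⟨j, hj, fun f hf _ => hP f hf⟩
  obtain ⟨j, hjl, hg⟩ := hj
  obtain ⟨l', rfl⟩ := Multiset.exists_cons_of_mem hjl
  have hfar : ∀ f : α → ZMod 2, farOnes ((j.1, j.2 + 1) ::ₘ l') f = farOnes (j ::ₘ l') f := by
    intro f; rw [farOnes_cons, farOnes_cons]
  have hlab : ∀ f : α → ZMod 2, labelOnes ((j.1, j.2 + 1) ::ₘ l') f + 2 * (j.2 + f j.1).val =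
      labelOnes (j ::ₘ l') f + 1 := by
    intro f
    have : ∀ s a : ZMod 2, (s + 1 + a).val + 2 * (s + a).val = (s + a).val + 1 := by decide
    have := this j.2 (f j.1)
    rw [labelOnes_cons, labelOnes_cons]
    dsimp only
    omega
  have hval : ∀ a : ZMod 2, a.val = 0 ∨ a.val = 1 ∧ a = 1 := by decide
  refine ⟨j, l', rfl, ⟨h.ends, ?_, ?_, ?_, ?_, ?_⟩⟩
  · intro p hp
    rcases Multiset.mem_cons.1 hp with rfl | hp
    · exact h.spokes j (by simp)
    · exact h.spokes p (by simp [hp])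
  · intro f; rw [hfar]; exact h.le_cut f
  · intro f hf
    have e1 := hlab f
    have e2 := h.le_frus f hf
    obtain ⟨c, hc⟩ := h.even_frus f hf
    rcases hval (j.2 + f j.1) with h0 | ⟨h0, hj⟩
    · omega
    · have := hg f hf hj
      omega
  · intro f; rw [hfar]; exact h.even_cut f
  · intro f hf
    have e1 := hlab f
    obtain ⟨c, hc⟩ := h.even_frus f hf
    exact ⟨c - (j.2 + f j.1).val, by omega⟩

end SignedGraph

namespace SignedGraph

variable {α β : Type*}

/-! ### Elimination of vertices -/

/-- A graph on `V` whose cuts have at least `2k` edges and whose potentials leave at least `m`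
inconsistent edges, where only functions constant on `Y` are considered. -/
structure Tough (Y V : Set α) (k m : ℕ) (M : Multiset (α × α × ZMod 2)) : Prop where
  ends : ∀ e ∈ M, e.1 ∈ V ∧ e.2.1 ∈ V
  le_cut : ∀ f, ConstOn Y f → Sep V f → 2 * k ≤ cut M f
  le_frus : ∀ f, ConstOn Y f → m ≤ frus M f
  even_cut : ∀ f, ConstOn Y f → Even (cut M f)
  even_frus : ∀ f, ConstOn Y f → Even (frus M f + m)

/-- The edges at `u` with their other ends and their signs. -/
def star (u : α) (l : Multiset (α × ZMod 2)) : Multiset (α × α × ZMod 2) :=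
  l.map fun p => (p.1, u, p.2)

/-- The loops at `u`. -/
def loops (u : α) (q : Multiset (ZMod 2)) : Multiset (α × α × ZMod 2) := q.map fun t => (u, u, t)

lemma star_cons (u : α) (p) (l : Multiset (α × ZMod 2)) :
    star u (p ::ₘ l) = (p.1, u, p.2) ::ₘ star u l := by simp [star]

lemma loops_cons (u : α) (t) (q : Multiset (ZMod 2)) :
    loops u (t ::ₘ q) = (u, u, t) ::ₘ loops u q := by simp [loops]

lemma Red.rfl {Y : Set α} {M : Multiset (α × α × ZMod 2)} : Red Y M M := Relation.ReflTransGen.refl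

/-- Reversals alone bring the edges into a normal form at `u`: the edges avoiding `u`, the spokes
pointing to `u`, and the loops. -/
lemma exists_star_form (Y V : Set α) (u : α) (M : Multiset (α × α × ZMod 2))
    (hM : ∀ e ∈ M, e.1 ∈ insert u V ∧ e.2.1 ∈ insert u V) :
    ∃ R l q, Red Y M (R + star u l + loops u q) ∧ (∀ e ∈ R, e.1 ∈ V ∧ e.2.1 ∈ V) ∧
      (∀ p ∈ l, p.1 ∈ V) ∧ (∀ f, cut M f = cut (R + star u l + loops u q) f) ∧
      ∀ f, frus M f = frus (R + star u l + loops u q) f := by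
  induction M using Multiset.induction with
  | empty => exact ⟨0, 0, 0, by simpa [star, loops] using Red.rfl (Y := Y) (M := 0), by simp,
      by simp, by simp [star, loops], by simp [star, loops]⟩
  | cons e M ih =>
    obtain ⟨R, l, q, h1, h2, h3, h4, h5⟩ := ih fun e he => hM e (by simp [he])
    obtain ⟨x, y, s⟩ := e
    have hx : x = u ∨ x ∈ V := (hM (x, y, s) (by simp)).1
    have hy : y = u ∨ y ∈ V := (hM (x, y, s) (by simp)).2
    have key : ∀ R' l' q' e', R' + star u l' + loops u q' = e' ::ₘ (R + star u l + loops u q) →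
        (e' = (x, y, s) ∨ e' = (y, x, s)) →
        Red Y ((x, y, s) ::ₘ M) (R' + star u l' + loops u q') ∧
        (∀ f, cut ((x, y, s) ::ₘ M) f = cut (R' + star u l' + loops u q') f) ∧
        ∀ f, frus ((x, y, s) ::ₘ M) f = frus (R' + star u l' + loops u q') f := by
      intro R' l' q' e' h he
      rw [h]
      rcases he with rfl | rfl
      · exact ⟨h1.cons _, fun f => by rw [cut_cons, cut_cons, h4],
          fun f => by rw [frus_cons, frus_cons, h5]⟩
      · exact ⟨(h1.cons _).tail (.flip ..), fun f => by rw [cut_cons, cut_cons, h4, add_comm (f x)],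
          fun f => by rw [frus_cons, frus_cons, h5, add_right_comm]⟩
    rcases hx with hx | hx <;> rcases hy with hy | hy
    · obtain ⟨k1, k2, k3⟩ := key R l (s ::ₘ q) (x, y, s) (by simp [loops_cons, hx, hy]) (.inl rfl)
      exact ⟨_, _, _, k1, h2, h3, k2, k3⟩
    · obtain ⟨k1, k2, k3⟩ := key R ((y, s) ::ₘ l) q (y, x, s) (by simp [star_cons, hx]) (.inr rfl)
      refine ⟨_, _, _, k1, h2, ?_, k2, k3⟩
      simpa [hy] using h3
    · obtain ⟨k1, k2, k3⟩ := key R ((x, s) ::ₘ l) q (x, y, s) (by simp [star_cons, hy]) (.inl rfl)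
      refine ⟨_, _, _, k1, h2, ?_, k2, k3⟩
      simpa [hx] using h3
    · obtain ⟨k1, k2, k3⟩ := key ((x, y, s) ::ₘ R) l q (x, y, s) (by simp) (.inl rfl)
      refine ⟨_, _, _, k1, ?_, h3, k2, k3⟩
      intro e he
      rcases Multiset.mem_cons.1 he with rfl | he
      · exact ⟨hx, hy⟩
      · exact h2 e he

lemma SpokeState.exists_red_of_star {Y V : Set α} {k m : ℕ} (hmk : m ≤ k) {u : α} (hu : u ∉ Y)
    (n : ℕ) {R : Multiset (α × α × ZMod 2)} {l : Multiset (α × ZMod 2)} (hn : l.card = n)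
    (h : SpokeState Y V k m R l 0) : ∃ M', Red Y (R + star u l) M' ∧ Tough Y V k m M' := by
  induction n using Nat.strong_induction_on generalizing R l with
  | _ n ih =>
  rcases Multiset.empty_or_exists_mem l with rfl | ⟨i, hi⟩
  · refine ⟨R, by simpa [star] using Red.rfl (Y := Y) (M := R), h.ends, ?_, ?_, ?_, ?_⟩
    · simpa [farOnes] using h.le_cut
    · simpa [labelOnes] using h.le_frus
    · simpa [farOnes] using h.even_cut
    · simpa [labelOnes] using h.even_frus
  · obtain ⟨l, rfl⟩ := Multiset.exists_cons_of_mem hi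
    obtain ⟨j, l', rfl, h'⟩ := h.exists_split hmk
    obtain ⟨M', hM', ht⟩ := ih l'.card (by simp at hn; omega) rfl h'
    refine ⟨M', ?_, ht⟩
    have h1 : R + star u (i ::ₘ j ::ₘ l') = (i.1, u, i.2) ::ₘ (j.1, u, j.2) ::ₘ (R + star u l') := by
      simp [star_cons]
    rw [h1]
    refine .head ?_ (.head (Step.join i.1 u j.1 i.2 j.2 (R + star u l') hu) (by simpa [Red] using hM'))
    rw [Multiset.cons_swap, Multiset.cons_swap (i.1, u, i.2)]
    exact .flip ..

/-- Loops are absorbed before any spokes are split off, because absorption keeps the number of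
spokes, whose lower bound `2k` is needed for each odd loop. An even loop can join any spoke. -/
lemma SpokeState.exists_red_of_loops {Y V : Set α} {k m : ℕ} (hk : 1 ≤ k) (hmk : m ≤ k) {u : α}
    (hu : u ∉ Y) {R : Multiset (α × α × ZMod 2)} {l : Multiset (α × ZMod 2)}
    {q : Multiset (ZMod 2)} (hl : 2 * k ≤ l.card)
    (h : SpokeState Y V k m R l (q.map ZMod.val).sum) :
    ∃ M', Red Y (R + star u l + loops u q) M' ∧ Tough Y V k m M' := by
  induction q using Multiset.induction generalizing l with
  | empty => simpa [loops] using h.exists_red_of_star hmk hu _ rfl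
  | cons t q ih =>
    rcases zmod2_cases t with rfl | rfl
    · obtain ⟨M', hM', ht⟩ := ih hl (by simpa using h)
      refine ⟨M', .head ?_ hM', ht⟩
      have : l ≠ 0 := by rintro rfl; simp at hl; omega
      obtain ⟨j, hj⟩ := Multiset.exists_mem_of_ne_zero this
      obtain ⟨l', rfl⟩ := Multiset.exists_cons_of_mem hj
      have := Step.join (Y := Y) j.1 u u j.2 0 (R + star u l' + loops u q) hu
      convert this using 1
      · simp only [star_cons, loops_cons, Multiset.add_cons, Multiset.cons_add]
        rw [Multiset.cons_swap]
      · simp [star_cons]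
    · have hq : ((1 ::ₘ q).map ZMod.val).sum = (q.map ZMod.val).sum + 1 := by
        rw [Multiset.map_cons, Multiset.sum_cons, add_comm, show (1 : ZMod 2).val = 1 by decide]
      rw [hq] at h
      obtain ⟨j, l', rfl, h'⟩ := h.exists_absorb hk hmk hl
      obtain ⟨M', hM', ht⟩ := ih (by simpa using hl) h'
      refine ⟨M', .head ?_ hM', ht⟩
      have := Step.join (Y := Y) j.1 u u j.2 1 (R + star u l' + loops u q) hu
      convert this using 1
      · simp only [star_cons, loops_cons, Multiset.add_cons, Multiset.cons_add]
        rw [Multiset.cons_swap]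
      · simp [star_cons]

lemma cut_star_form (u : α) (R : Multiset (α × α × ZMod 2)) (l : Multiset (α × ZMod 2))
    (q : Multiset (ZMod 2)) (f : α → ZMod 2) (hf : f u = 0) :
    cut (R + star u l + loops u q) f = cut R f + farOnes l f := by
  have h : (0 : ZMod 2).val = 0 := by decide
  simp [cut, star, loops, farOnes, hf]

lemma frus_star_form (u : α) (R : Multiset (α × α × ZMod 2)) (l : Multiset (α × ZMod 2))
    (q : Multiset (ZMod 2)) (f : α → ZMod 2) (hf : f u = 0) :
    frus (R + star u l + loops u q) f = frus R f + labelOnes l f + (q.map ZMod.val).sum := by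
  simp [frus, star, loops, labelOnes, hf]

lemma Tough.exists_red {Y V : Set α} {k m : ℕ} (hk : 1 ≤ k) (hmk : m ≤ k) {u : α} (hu : u ∉ Y)
    (huV : u ∉ V) (hV : V.Nonempty) {M : Multiset (α × α × ZMod 2)}
    (h : Tough Y (insert u V) k m M) : ∃ M', Red Y M M' ∧ Tough Y V k m M' := by
  classical
  obtain ⟨R, l, q, h1, h2, h3, h4, h5⟩ := exists_star_form Y V u M h.ends
  have hfar : ∀ f, farOnes l (Function.update f u 0) = farOnes l f := by
    intro f
    unfold farOnes
    congr 1
    refine Multiset.map_congr rfl fun p hp => ?_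
    rw [Function.update_of_ne]
    rintro rfl
    exact huV (h3 p hp)
  have hlab : ∀ f, labelOnes l (Function.update f u 0) = labelOnes l f := by
    intro f
    unfold labelOnes
    congr 1
    refine Multiset.map_congr rfl fun p hp => ?_
    rw [Function.update_of_ne]
    rintro rfl
    exact huV (h3 p hp)
  have hupd : ∀ f : α → ZMod 2, ∀ x ∈ V, Function.update f u 0 x = f x := by
    intro f x hx
    rw [Function.update_of_ne]
    rintro rfl
    exact huV hx
  have hcut : ∀ f, cut M (Function.update f u 0) = cut R f + farOnes l f := by
    intro f
    rw [h4, cut_star_form _ _ _ _ _ (by simp), cut_congr h2 (hupd f), hfar]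
  have hfrus : ∀ f, frus M (Function.update f u 0) =
      frus R f + labelOnes l f + (q.map ZMod.val).sum := by
    intro f
    rw [h5, frus_star_form _ _ _ _ _ (by simp), frus_congr h2 (hupd f), hlab]
  have hconst : ∀ f, ConstOn Y f → ConstOn Y (Function.update f u 0) := by
    intro f hf x hx y hy
    rw [Function.update_of_ne, Function.update_of_ne]
    · exact hf x hx y hy
    · rintro rfl; exact hu hy
    · rintro rfl; exact hu hx
  -- The state at `u` speaks of potentials normalised to vanish at `u`. Resetting that value keeps
  -- them constant on `Y`, since `u ∉ Y`.
  have hst : SpokeState Y V k m R l (q.map ZMod.val).sum := by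
    refine ⟨h2, h3, ?_, ?_, ?_, ?_⟩
    · intro f hf ⟨x, hx, y, hy, hxy⟩
      rw [← hcut]
      refine h.le_cut _ (hconst f hf) ⟨x, .inr hx, y, .inr hy, ?_⟩
      rwa [hupd f x hx, hupd f y hy]
    · intro f hf
      rw [← hfrus]
      exact h.le_frus _ (hconst f hf)
    · intro f hf
      rw [← hcut]
      exact h.even_cut _ (hconst f hf)
    · intro f hf
      rw [← hfrus]
      exact h.even_frus _ (hconst f hf)
  -- The cut that isolates `u` consists of the spokes.
  have hl : 2 * k ≤ l.card := by
    obtain ⟨y, hy⟩ := hV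
    have := h.le_cut (Function.update 1 u 0) (hconst _ constOn_one) ⟨u, .inl rfl, y, .inr hy, by
      rw [hupd _ y hy]; simp⟩
    rw [hcut] at this
    have h0 : cut R 1 = 0 := by
      have : ((1 : ZMod 2) + 1).val = 0 := by decide
      simp [cut, this]
    have := farOnes_le_card l 1
    omega
  obtain ⟨M', hM', ht⟩ := hst.exists_red_of_loops hk hmk hu hl
  exact ⟨M', h1.trans hM', ht⟩

/-- All vertices outside `Y` can be eliminated. -/
theorem Tough.exists_red_root {Y : Set α} {k m : ℕ} (hk : 1 ≤ k) (hmk : m ≤ k) (hY : Y.Nonempty)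
    (X : Finset α) (hX : Disjoint Y X) {M : Multiset (α × α × ZMod 2)}
    (h : Tough Y (Y ∪ X) k m M) : ∃ M', Red Y M M' ∧ Tough Y Y k m M' := by
  classical
  induction X using Finset.induction_on generalizing M with
  | empty => exact ⟨M, .refl, by simpa using h⟩
  | insert u X hu ih =>
    rw [Finset.coe_insert, Set.disjoint_insert_right] at hX
    rw [Finset.coe_insert, Set.union_insert] at h
    obtain ⟨M₁, h1, h2⟩ := h.exists_red hk hmk hX.1 (by simp [hX.1, hu]) (hY.mono (by simp))
    obtain ⟨M₂, h3, h4⟩ := ih hX.2 h2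
    exact ⟨M₂, h1.trans h3, h4⟩

end SignedGraph

namespace SignedGraph

variable {α β : Type*}

/-! ### Lifting splittings to edges with additional data -/

/-- Splitting off sees only ends and signs. Any invariant of richer edges that survives reversal and
concatenation is carried along, so reduced edges can remember the walks they stand for. -/
theorem Red.lift {τ : Type*} {Y : Set α} (sh : τ → α × α × ZMod 2) (P : Multiset τ → Prop)
    (hflip : ∀ t R, P (t ::ₘ R) →
      ∃ t', sh t' = ((sh t).2.1, (sh t).1, (sh t).2.2) ∧ P (t' ::ₘ R))
    (hjoin : ∀ t₁ t₂ R, (sh t₁).2.1 = (sh t₂).1 → (sh t₁).2.1 ∉ Y → P (t₁ ::ₘ t₂ ::ₘ R) →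
      ∃ t, sh t = ((sh t₁).1, (sh t₂).2.1, (sh t₁).2.2 + (sh t₂).2.2) ∧ P (t ::ₘ R))
    {M M' : Multiset (α × α × ZMod 2)} (h : Red Y M M') (N : Multiset τ) (hN : N.map sh = M)
    (hP : P N) : ∃ N', N'.map sh = M' ∧ P N' := by
  classical
  induction h with
  | refl => exact ⟨N, hN, hP⟩
  | tail _ hs ih =>
    obtain ⟨N₁, h1, h2⟩ := ih
    cases hs with
    | flip x y s R =>
      obtain ⟨t, ht, hts, hR⟩ := (Multiset.map_eq_cons sh N₁ R (x, y, s)).2 h1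
      rw [← Multiset.cons_erase ht] at h2
      obtain ⟨t', h3, h4⟩ := hflip _ _ h2
      exact ⟨_, by rw [Multiset.map_cons, hR, h3, hts], h4⟩
    | join x u y s t R hu =>
      obtain ⟨t₁, ht₁, hts₁, hR₁⟩ := (Multiset.map_eq_cons sh N₁ _ (x, u, s)).2 h1
      obtain ⟨t₂, ht₂, hts₂, hR₂⟩ := (Multiset.map_eq_cons sh _ R (u, y, t)).2 hR₁
      rw [← Multiset.cons_erase ht₁, ← Multiset.cons_erase ht₂] at h2
      obtain ⟨t', h3, h4⟩ := hjoin _ _ _ (by rw [hts₁, hts₂]) (by rw [hts₁]; exact hu) h2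
      exact ⟨_, by rw [Multiset.map_cons, hR₂, h3, hts₁, hts₂], h4⟩

/-! ### Walks -/

/-- `IsWalk G x l y`: the edges in `l` form a walk from `x` to `y`. -/
inductive IsWalk (G : Graph α β) : α → List β → α → Prop
  | nil (x : α) : IsWalk G x [] x
  | cons {e : β} {x y z : α} {l : List β} (h : G.IsLink e x y) (hl : IsWalk G y l z) :
      IsWalk G x (e :: l) z

lemma IsWalk.append {G : Graph α β} {x y z : α} {l l' : List β} (h : IsWalk G x l y)
    (h' : IsWalk G y l' z) : IsWalk G x (l ++ l') z := by
  induction h with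
  | nil => exact h'
  | cons h _ ih => exact .cons h (ih h')

lemma IsWalk.reverse {G : Graph α β} {x y : α} {l : List β} (h : IsWalk G x l y) :
    IsWalk G y l.reverse x := by
  induction h with
  | nil => exact .nil _
  | cons h _ ih =>
    rw [List.reverse_cons]
    exact ih.append (.cons h.symm (.nil _))

lemma IsWalk.edge_mem {G : Graph α β} {x y : α} {l : List β} (h : IsWalk G x l y) :
    ∀ e ∈ l, e ∈ E(G) := by
  induction h with
  | nil => simp
  | cons h _ ih =>
    intro e he
    rcases List.mem_cons.1 he with rfl | he
    · exact h.edge_mem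
    · exact ih e he

lemma IsWalk.mono {G H : Graph α β} (hle : H ≤ G) {x y : α} {l : List β} (h : IsWalk H x l y) :
    IsWalk G x l y := by
  induction h with
  | nil => exact .nil _
  | cons h _ ih => exact .cons (h.mono hle) ih

lemma exists_isWalk_join {G : Graph α β} {v : α} (M : Multiset (List β))
    (hM : ∀ l ∈ M, IsWalk G v l v) :
    ∃ l, IsWalk G v l v ∧ Multiset.ofList l = (M.map Multiset.ofList).sum := by
  induction M using Multiset.induction with
  | empty => exact ⟨[], .nil v, rfl⟩
  | cons l M ih =>
    obtain ⟨l', h1, h2⟩ := ih fun l hl => hM l (by simp [hl])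
    exact ⟨l ++ l', (hM l (by simp)).append h1, by
      rw [Multiset.map_cons, Multiset.sum_cons, ← h2, Multiset.coe_add]⟩

/-! ### Valencies -/

open Classical in
/-- The number of half-edges of `e` at `z`. -/
noncomputable def halves (G : Graph α β) (z : α) (e : β) : ℕ :=
  (if G.Inc e z then 1 else 0) + (if G.IsLoopAt e z then 1 else 0)

open Classical in
lemma halves_eq {G : Graph α β} {e : β} {x y : α} (h : G.IsLink e x y) (z : α) :
    halves G z e = (if x = z then 1 else 0) + (if y = z then 1 else 0) := by
  have h1 : G.Inc e z ↔ x = z ∨ y = z := by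
    constructor
    · intro hz
      rcases hz.eq_or_eq_of_isLink h with rfl | rfl <;> simp
    · rintro (rfl | rfl)
      exacts [h.inc_left, h.inc_right]
  have h2 : G.IsLoopAt e z ↔ x = z ∧ y = z := by
    constructor
    · intro hz
      exact ⟨(hz.eq_of_inc h.inc_left).symm, (hz.eq_of_inc h.inc_right).symm⟩
    · rintro ⟨rfl, rfl⟩
      exact h
  unfold halves
  by_cases hx : x = z <;> by_cases hy : y = z <;> simp [h1, h2, hx, hy]

lemma valency_eq_sum {G : Graph α β} (S : Finset β) (hS : E(G) = S) (z : α) :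
    valency G z = ∑ e ∈ S, halves G z e := by
  classical
  have h1 : G.incidenceSet z = ↑(S.filter fun e => G.Inc e z) := by
    ext e
    simp only [Graph.mem_incidenceSet, Finset.coe_filter, Set.mem_ofPred_eq]
    exact ⟨fun h => ⟨by rw [← Finset.mem_coe, ← hS]; exact h.edge_mem, h⟩, fun h => h.2⟩
  have h2 : G.loopSet z = ↑(S.filter fun e => G.IsLoopAt e z) := by
    ext e
    simp only [Graph.mem_loopSet, Finset.coe_filter, Set.mem_ofPred_eq]
    exact ⟨fun h => ⟨by rw [← Finset.mem_coe, ← hS]; exact h.edge_mem, h⟩, fun h => h.2⟩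
  simp only [valency, h1, h2, Set.ncard_coe_finset, halves, Finset.sum_add_distrib,
    Finset.sum_boole, Nat.cast_id]

/-- Summing a function over the ends of all edges. -/
lemma sum_ends {G : Graph α β} {A : Type*} [AddCommMonoid A] (S : Finset β) (hS : E(G) = S)
    (W : Finset α) (hW : V(G) = W) (a b : β → α) (hab : ∀ e ∈ S, G.IsLink e (a e) (b e))
    (F : α → A) : ∑ e ∈ S, (F (a e) + F (b e)) = ∑ v ∈ W, valency G v • F v := by
  classical
  have h : ∀ v ∈ W, valency G v • F v = ∑ e ∈ S, halves G v e • F v := fun v _ => by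
    rw [valency_eq_sum S hS, Finset.sum_smul]
  rw [Finset.sum_congr rfl h, Finset.sum_comm]
  refine Finset.sum_congr rfl fun e he => ?_
  have ha : a e ∈ W := by rw [← Finset.mem_coe, ← hW]; exact (hab e he).left_mem
  have hb : b e ∈ W := by rw [← Finset.mem_coe, ← hW]; exact (hab e he).right_mem
  simp only [halves_eq (hab e he), add_smul, ite_smul, one_smul, zero_smul]
  rw [Finset.sum_add_distrib, Finset.sum_ite_eq, Finset.sum_ite_eq, if_pos ha, if_pos hb]

lemma IsWalk.sum_halves {G : Graph α β} {x y : α} {l : List β} (h : IsWalk G x l y) (z : α) :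
    Even ((l.map (halves G z)).sum) ↔ (x = z ↔ y = z) := by
  classical
  induction h with
  | nil => simp
  | @cons e x y w l h _ ih =>
    rw [List.map_cons, List.sum_cons, Nat.even_add, ih, halves_eq h]
    by_cases hx : x = z <;> by_cases hy : y = z <;> by_cases hw : w = z <;> simp [hx, hy, hw]

/-- The subgraph formed by the edges of a list and a vertex. -/
def trailGraph (G : Graph α β) (v : α) (l : List β) : Graph α β where
  vertexSet := insert v {z | ∃ e ∈ l, G.Inc e z}
  edgeSet := {e | e ∈ l ∧ e ∈ E(G)}
  IsLink e x y := e ∈ l ∧ G.IsLink e x y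
  isLink_symm := fun _ _ => ⟨fun _ _ h => ⟨h.1, h.2.symm⟩⟩
  eq_or_eq_of_isLink_of_isLink := fun _ _ _ _ _ h h' => h.2.left_eq_or_eq h'.2
  edge_mem_iff_exists_isLink := fun e => by
    constructor
    · rintro ⟨h, h'⟩
      obtain ⟨x, y, hxy⟩ := G.exists_isLink_of_mem_edgeSet h'
      exact ⟨x, y, h, hxy⟩
    · rintro ⟨x, y, h, hxy⟩
      exact ⟨h, hxy.edge_mem⟩
  left_mem_of_isLink := fun _ _ _ h => .inr ⟨_, h.1, h.2.inc_left⟩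

lemma trailGraph_le {G : Graph α β} {v : α} (hv : v ∈ V(G)) (l : List β) : trailGraph G v l ≤ G := by
  refine ⟨?_, fun _ _ _ h => h.2⟩
  rintro z (rfl | ⟨e, _, h⟩)
  · exact hv
  · exact h.vertex_mem

lemma IsWalk.reachable {G H : Graph α β} {x y : α} {l : List β} (h : IsWalk G x l y)
    (hl : ∀ e ∈ l, ∀ x y, G.IsLink e x y → H.IsLink e x y) :
    ∀ e ∈ l, ∀ z, G.Inc e z → Relation.ReflTransGen H.Adj x z := by
  induction h with
  | nil => simp
  | @cons e x y w l h _ ih =>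
    intro e' he' z hz
    have hxy : H.Adj x y := ⟨e, hl e (by simp) x y h⟩
    rcases List.mem_cons.1 he' with rfl | he'
    · rcases hz.eq_or_eq_of_isLink h with rfl | rfl
      · exact .refl
      · exact .single hxy
    · exact .head hxy (ih (fun e he => hl e (by simp [he])) e' he' z hz)

lemma IsWalk.isEulerian_trailGraph {G : Graph α β} {v : α} {l : List β} (h : IsWalk G v l v)
    (hl : l.Nodup) : IsEulerian (trailGraph G v l) := by
  classical
  have hreach : ∀ z ∈ V(trailGraph G v l), Relation.ReflTransGen (trailGraph G v l).Adj v z := by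
    rintro z (rfl | ⟨e, he, hz⟩)
    · exact .refl
    · exact h.reachable (H := trailGraph G v l) (fun e he x y hxy => ⟨he, hxy⟩) e he z hz
  refine ⟨⟨⟨v, .inl rfl⟩, fun x hx y hy => ?_⟩, fun x _ => ?_⟩
  · exact (Relation.ReflTransGen.stdSymm.symm _ _ (hreach x hx)).trans (hreach y hy)
  · have hS : E(trailGraph G v l) = (l.toFinset : Set β) := by
      ext e
      simp only [List.coe_toFinset, Set.mem_ofPred_eq]
      exact ⟨fun h => h.1, fun he => ⟨he, h.edge_mem e he⟩⟩
    rw [valency_eq_sum _ hS, List.sum_toFinset _ hl, List.map_congr_left (g := halves G x)]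
    · exact (h.sum_halves x).2 Iff.rfl
    · intro e he
      obtain ⟨a, b, hab⟩ := G.exists_isLink_of_mem_edgeSet (h.edge_mem e he)
      rw [halves_eq hab, halves_eq (show (trailGraph G v l).IsLink e a b from ⟨he, hab⟩)]

/-! ### Eulerian trails -/

lemma sep_iff_of_connected {G : Graph α β} (hG : IsConnected G) {f : α → ZMod 2}
    (hf : Sep V(G) f) : ∃ e x y, G.IsLink e x y ∧ f x ≠ f y := by
  by_contra hno
  push Not at hno
  obtain ⟨x, hx, y, hy, hxy⟩ := hf
  refine hxy ?_
  have := hG.2 x hx y hy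
  clear hxy hy
  induction this with
  | refl => rfl
  | tail _ h ih => obtain ⟨e, he⟩ := h; exact ih.trans (hno e _ _ he)

lemma natCast_val_zmod2 (a : ZMod 2) : ((a.val : ℕ) : ZMod 2) = a := ZMod.natCast_zmod_val a

lemma even_cut_of_eulerian {G : Graph α β} (hG : IsEulerian G) (S : Finset β) (hS : E(G) = S)
    (W : Finset α) (hW : V(G) = W) (a b : β → α) (hab : ∀ e ∈ S, G.IsLink e (a e) (b e))
    (f : α → ZMod 2) : Even (∑ e ∈ S, (f (a e) + f (b e)).val) := by
  rw [← ZMod.natCast_eq_zero_iff_even, Nat.cast_sum]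
  simp only [natCast_val_zmod2]
  rw [sum_ends S hS W hW a b hab]
  refine Finset.sum_eq_zero fun v hv => ?_
  have : Even (valency G v) := hG.2 v (by rw [hW]; exact hv)
  obtain ⟨c, hc⟩ := this
  rw [hc, add_smul]
  exact CharTwo.add_self_eq_zero _

lemma le_cut_of_connected {G : Graph α β} (hG : IsConnected G) (S : Finset β) (hS : E(G) = S)
    (a b : β → α) (hab : ∀ e ∈ S, G.IsLink e (a e) (b e))
    {f : α → ZMod 2} (hf : Sep V(G) f) : 1 ≤ ∑ e ∈ S, (f (a e) + f (b e)).val := by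
  obtain ⟨e, x, y, he, hne⟩ := sep_iff_of_connected hG hf
  have heS : e ∈ S := by rw [← Finset.mem_coe, ← hS]; exact he.edge_mem
  refine le_trans ?_ (Finset.single_le_sum (fun _ _ => Nat.zero_le _) heS)
  have : f (a e) + f (b e) = 1 := by
    rcases (hab e heS).eq_and_eq_or_eq_and_eq he with ⟨h1, h2⟩ | ⟨h1, h2⟩
    · rw [h1, h2]; exact zmod2_ne hne
    · rw [h1, h2]; exact zmod2_ne hne.symm
  rw [this]; decide

lemma exists_ends [Nonempty α] (G : Graph α β) : ∃ a b : β → α, ∀ e ∈ E(G), G.IsLink e (a e) (b e) := by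
  classical
  have h : ∀ e, ∃ p : α × α, e ∈ E(G) → G.IsLink e p.1 p.2 := by
    intro e
    by_cases he : e ∈ E(G)
    · obtain ⟨x, y, hxy⟩ := G.exists_isLink_of_mem_edgeSet he
      exact ⟨(x, y), fun _ => hxy⟩
    · exact ⟨(Classical.arbitrary α, Classical.arbitrary α), fun h => absurd h he⟩
  choose p hp using h
  exact ⟨fun e => (p e).1, fun e => (p e).2, hp⟩

/-- Every finite eulerian graph has a closed eulerian trail based at any given vertex. -/
theorem IsEulerian.exists_trail {G : Graph α β} (hG : IsEulerian G) (hV : V(G).Finite)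
    (hE : E(G).Finite) {v : α} (hv : v ∈ V(G)) :
    ∃ l, IsWalk G v l v ∧ l.Nodup ∧ ∀ e, e ∈ l ↔ e ∈ E(G) := by
  classical
  have : Nonempty α := ⟨v⟩
  obtain ⟨a, b, hab⟩ := exists_ends G
  set S := hE.toFinset with hSdef
  have hS : E(G) = S := by simp [S]
  have hW : V(G) = hV.toFinset := by simp
  have hab' : ∀ e ∈ S, G.IsLink e (a e) (b e) := fun e he => hab e (by simpa [S] using he)
  let N : Multiset (α × α × List β) := S.val.map fun e => (a e, b e, [e])
  let sh : α × α × List β → α × α × ZMod 2 := fun t => (t.1, t.2.1, 0)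
  have hcut : ∀ f, cut (N.map sh) f = ∑ e ∈ S, (f (a e) + f (b e)).val := by
    intro f; simp [cut, N, sh]
  have hfrus : ∀ f, frus (N.map sh) f = ∑ e ∈ S, (f (a e) + f (b e)).val := by
    intro f; simp [frus, N, sh]
  have hset : ({v} : Set α) ∪ ↑(hV.toFinset.erase v) = V(G) := by
    ext x
    by_cases hx : x = v <;> simp [hx, hv]
  -- All labels are `0` and `m = 0`, so only cuts matter: they are nonempty by connectivity and even
  -- by the valencies, hence of size at least `2`.
  have ht : Tough {v} ({v} ∪ ↑(hV.toFinset.erase v)) 1 0 (N.map sh) := by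
    rw [hset]
    have hev := even_cut_of_eulerian hG S hS _ hW a b hab'
    refine ⟨?_, ?_, fun f _ => Nat.zero_le _, ?_, ?_⟩
    · intro e he
      simp only [N, sh, Multiset.map_map, Multiset.mem_map, Function.comp] at he
      obtain ⟨e, he, rfl⟩ := he
      exact ⟨(hab' e he).left_mem, (hab' e he).right_mem⟩
    · intro f _ hf
      have h1 := le_cut_of_connected hG.1 S hS a b hab' hf
      obtain ⟨c, hc⟩ := hev f
      rw [hcut]
      omega
    · intro f _; rw [hcut]; exact hev f
    · intro f _; rw [hfrus]; simpa using hev f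
  obtain ⟨M', hM', ht'⟩ := ht.exists_red_root le_rfl (by simp) (Set.singleton_nonempty v) _
    (by simp)
  obtain ⟨N', hN', hw, hs⟩ := hM'.lift sh
    (fun N => (∀ t ∈ N, IsWalk G t.1 t.2.2 t.2.1) ∧
      (N.map fun t => Multiset.ofList t.2.2).sum = S.val) (by
      rintro ⟨x, y, l⟩ R ⟨h1, h2⟩
      refine ⟨(y, x, l.reverse), rfl, ?_, ?_⟩
      · intro t ht
        rcases Multiset.mem_cons.1 ht with rfl | ht
        · exact (h1 (x, y, l) (by simp)).reverse
        · exact h1 t (by simp [ht])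
      · rw [← h2]; simp) (by
      rintro ⟨x, u, l⟩ ⟨u', y, l'⟩ R hu _ ⟨h1, h2⟩
      obtain rfl : u = u' := hu
      refine ⟨(x, y, l ++ l'), by simp [sh], ?_, ?_⟩
      · intro t ht
        rcases Multiset.mem_cons.1 ht with rfl | ht
        · exact (h1 (x, u, l) (by simp)).append (h1 (u, y, l') (by simp))
        · exact h1 t (by simp [ht])
      · rw [← h2]; simp [add_assoc, ← Multiset.coe_add]) N rfl (by
      refine ⟨?_, ?_⟩
      · intro t ht
        obtain ⟨e, he, rfl⟩ := Multiset.mem_map.1 ht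
        exact .cons (hab' e he) (.nil _)
      · simp [N])
  obtain ⟨l, hl, hsum⟩ := exists_isWalk_join (G := G) (v := v) (N'.map fun t => t.2.2) (by
    intro l hl
    obtain ⟨t, ht, rfl⟩ := Multiset.mem_map.1 hl
    have h1 := ht'.ends (sh t) (by rw [← hN']; exact Multiset.mem_map_of_mem _ ht)
    have h2 := hw t ht
    have h3 : t.1 = v := h1.1
    have h4 : t.2.1 = v := h1.2
    rwa [h3, h4] at h2)
  rw [Multiset.map_map] at hsum
  have hl2 : (l : Multiset β) = S.val := hsum.trans hs
  refine ⟨l, hl, ?_, fun e => ?_⟩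
  · rw [← Multiset.coe_nodup, hl2]; exact S.nodup
  · rw [← Multiset.mem_coe, hl2, Finset.mem_val, hSdef, Set.Finite.mem_toFinset]

end SignedGraph

/-! ### Directed walks as edges, and nets modulo 3 -/

namespace SignedGraph

variable {α β : Type*}

/-- `1` or `-1`, according to parity. -/
def pm (s : ZMod 2) : ZMod 3 := if s = 0 then 1 else -1

/-- A walk with two directed ends; a value `0` of `sOut` or `tOut` stands for a half-edge that is
directed out of its end-vertex. -/
structure FlowEdge (α β : Type*) where
  src : α
  sOut : ZMod 2
  tgt : α
  tOut : ZMod 2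
  walk : List β

namespace FlowEdge

/-- The parity of the number of negative edges. -/
def par (neg : β → ZMod 2) (t : FlowEdge α β) : ZMod 2 := (t.walk.map neg).sum

open Classical in
/-- The parity after switching the signs of the half-edges in `Z` according to direction. -/
noncomputable def parAt (neg : β → ZMod 2) (Z : Set α) (t : FlowEdge α β) : ZMod 2 :=
  t.par neg + ((if t.src ∈ Z then t.sOut else 0) + (if t.tgt ∈ Z then t.tOut else 0))

/-- The signed edge underlying a walk. -/
noncomputable def shape (neg : β → ZMod 2) (Z : Set α) (t : FlowEdge α β) : α × α × ZMod 2 :=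
  (t.src, t.tgt, t.parAt neg Z)

open Classical in
/-- The contribution to the excess at a vertex. -/
noncomputable def exc (x : α) (t : FlowEdge α β) : ZMod 3 :=
  (if t.src = x then pm t.sOut else 0) + (if t.tgt = x then pm t.tOut else 0)

end FlowEdge

open FlowEdge

/-- Joins happen only outside `Y ⊇ Z`, so the half-edges at `Y` keep their directions. Hence the
switched parity is additive, and the excesses at `Y` do not change. -/
lemma exists_red_lift {G : Graph α β} (neg : β → ZMod 2) {Y Z : Set α} (hZ : Z ⊆ Y)
    {N : Multiset (FlowEdge α β)} {M' : Multiset (α × α × ZMod 2)}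
    (h : Red Y (N.map (shape neg Z)) M') (hN : ∀ t ∈ N, IsWalk G t.src t.walk t.tgt) :
    ∃ N' : Multiset (FlowEdge α β), N'.map (shape neg Z) = M' ∧
      (∀ t ∈ N', IsWalk G t.src t.walk t.tgt) ∧
      (N'.map fun t => Multiset.ofList t.walk).sum = (N.map fun t => Multiset.ofList t.walk).sum ∧
      ∀ y ∈ Y, (N'.map (exc y)).sum = (N.map (exc y)).sum := by
  refine h.lift _ (fun N' => (∀ t ∈ N', IsWalk G t.src t.walk t.tgt) ∧
      (N'.map fun t => Multiset.ofList t.walk).sum = (N.map fun t => Multiset.ofList t.walk).sum ∧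
      ∀ y ∈ Y, (N'.map (exc y)).sum = (N.map (exc y)).sum) ?_ ?_ N rfl ⟨hN, rfl, fun _ _ => rfl⟩
  · rintro ⟨x, a, y, b, l⟩ R ⟨h1, h2, h3⟩
    refine ⟨⟨y, b, x, a, l.reverse⟩, ?_, ?_, ?_, ?_⟩
    · simp [shape, parAt, par, add_comm]
    · intro t ht
      rcases Multiset.mem_cons.1 ht with rfl | ht
      · exact (h1 ⟨x, a, y, b, l⟩ (by simp)).reverse
      · exact h1 t (by simp [ht])
    · rw [← h2]; simp
    · intro z hz
      rw [← h3 z hz]; simp [exc, add_comm]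
  · rintro ⟨x, a, u, b, l⟩ ⟨u', b', y, c, l'⟩ R hu hY ⟨h1, h2, h3⟩
    obtain rfl : u = u' := hu
    change u ∉ Y at hY
    have huZ : u ∉ Z := fun h => hY (hZ h)
    refine ⟨⟨x, a, y, c, l ++ l'⟩, ?_, ?_, ?_, ?_⟩
    · simp only [shape, parAt, par, List.map_append, List.sum_append, huZ, if_false]
      refine Prod.ext rfl (Prod.ext rfl ?_)
      simp only
      ring
    · intro t ht
      rcases Multiset.mem_cons.1 ht with rfl | ht
      · exact (h1 ⟨x, a, u, b, l⟩ (by simp)).append (h1 ⟨u, b', y, c, l'⟩ (by simp))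
      · exact h1 t (by simp [ht])
    · rw [← h2]; simp [← Multiset.coe_add, add_assoc]
    · intro z hz
      have : u ≠ z := fun h => hY (h ▸ hz)
      rw [← h3 z hz]; simp [exc, this, add_assoc]

/-- The excesses of a set of vertices, as a sum over edges. -/
lemma sum_mul_exc (W : Finset α) (F : α → ZMod 3) (N : Multiset (FlowEdge α β)) [DecidableEq α] :
    ∑ x ∈ W, F x * (N.map (exc x)).sum = (N.map fun t =>
      (if t.src ∈ W then F t.src * pm t.sOut else 0) +
      (if t.tgt ∈ W then F t.tgt * pm t.tOut else 0)).sum := by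
  induction N using Multiset.induction with
  | empty => simp
  | cons t N ih =>
    simp only [Multiset.map_cons, Multiset.sum_cons, mul_add, Finset.sum_add_distrib, ih, exc,
      mul_ite, mul_zero, Finset.sum_ite_eq]

lemma exists_cons_of_sum_ne_zero {τ : Type*} {M : Multiset τ} {F : τ → ℕ}
    (h : (M.map F).sum ≠ 0) : ∃ t R, M = t ::ₘ R ∧ F t ≠ 0 := by
  by_contra hno
  push Not at hno
  refine h (Multiset.sum_eq_zero fun n hn => ?_)
  obtain ⟨t, ht, rfl⟩ := Multiset.mem_map.1 hn
  obtain ⟨R, rfl⟩ := Multiset.exists_cons_of_mem ht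
  exact hno t R rfl

lemma sum_parity {τ : Type*} (M : Multiset τ) (F : τ → ZMod 2) :
    (((M.map fun t => (F t).val).sum : ℕ) : ZMod 2) = (M.map F).sum := by
  rw [Nat.cast_multiset_sum, Multiset.map_map]
  simp

lemma sum_map_map_neg (neg : β → ZMod 2) (N : Multiset (FlowEdge α β)) :
    ((N.map fun t => Multiset.ofList t.walk).sum.map neg).sum = (N.map (par neg)).sum := by
  induction N using Multiset.induction with
  | empty => simp
  | cons t N ih => simp [ih, par]

/-- The number of edges between the two classes of `f`. -/
def cross (N : Multiset (FlowEdge α β)) (f : α → ZMod 2) : ℕ :=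
  (N.map fun t => (f t.src + f t.tgt).val).sum

lemma cut_map_shape (neg : β → ZMod 2) (Z : Set α) (N : Multiset (FlowEdge α β)) (f : α → ZMod 2) :
    cut (N.map (shape neg Z)) f = cross N f := by
  simp only [cut, cross, Multiset.map_map]; rfl

lemma frus_map_shape (neg : β → ZMod 2) (Z : Set α) (N : Multiset (FlowEdge α β))
    (f : α → ZMod 2) : frus (N.map (shape neg Z)) f =
      (N.map fun t => (t.parAt neg Z + f t.src + f t.tgt).val).sum := by
  simp only [frus, Multiset.map_map]; rfl

lemma frus_cast (neg : β → ZMod 2) (Z : Set α) (N : Multiset (FlowEdge α β))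
    (f : α → ZMod 2) : (frus (N.map (shape neg Z)) f : ZMod 2) =
      (N.map (parAt neg Z)).sum + (cross N f : ℕ) := by
  rw [frus_map_shape, cross, sum_parity, sum_parity, ← Multiset.sum_map_add]
  simp only [add_assoc]

/-- A connected signed graph with vertex set `V`, with walks of `G` for edges, all of whose
cuts are even, that is directed such that the excesses vanish modulo `3`. -/
structure IsNet (G : Graph α β) (neg : β → ZMod 2) (V : Set α) (N : Multiset (FlowEdge α β)) :
    Prop where
  ends : ∀ t ∈ N, t.src ∈ V ∧ t.tgt ∈ V
  walk : ∀ t ∈ N, IsWalk G t.src t.walk t.tgt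
  par_eq : ∀ t ∈ N, t.par neg = 1 + t.sOut + t.tOut
  even_cross : ∀ f, Even (cross N f)
  one_le_cross : ∀ f, Sep V f → 1 ≤ cross N f
  exc_eq : ∀ x ∈ V, (N.map (exc x)).sum = 0
  odd : (N.map (par neg)).sum = 1

lemma parAt_empty (neg : β → ZMod 2) (t : FlowEdge α β) : t.parAt neg ∅ = t.par neg := by
  simp [parAt]

/-- Weight the excess at `x` by `pm (f x)` and sum. Every consistent edge contributes `0` and an
inconsistent one contributes `±2`, so a single inconsistent edge would give a nonzero total modulo
3. -/
lemma IsNet.frus_ne_one {G : Graph α β} {neg : β → ZMod 2} {V : Finset α}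
    {N : Multiset (FlowEdge α β)} (h : IsNet G neg V N) (f : α → ZMod 2) :
    frus (N.map (shape neg ∅)) f ≠ 1 := by
  classical
  intro h1
  rw [frus_map_shape] at h1
  simp only [parAt_empty] at h1
  obtain ⟨t, R, rfl, ht⟩ := exists_cons_of_sum_ne_zero (h1.trans_ne one_ne_zero)
  rw [Multiset.map_cons, Multiset.sum_cons] at h1
  have hR : ∀ r ∈ R, r.par neg + f r.src + f r.tgt = 0 := by
    have h0 : (R.map fun r => (r.par neg + f r.src + f r.tgt).val).sum = 0 := by omega
    intro r hr
    rw [Multiset.sum_eq_zero_iff] at h0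
    exact (ZMod.val_eq_zero _).1 (h0 _ (Multiset.mem_map_of_mem _ hr))
  have ht1 : t.par neg + f t.src + f t.tgt = 1 := by
    refine zmod2_ne_zero fun h0 => ht ?_
    rw [h0]; rfl
  have hs := sum_mul_exc V (fun x => pm (f x)) (t ::ₘ R)
  rw [Finset.sum_eq_zero fun x hx => by rw [h.exc_eq x hx, mul_zero]] at hs
  rw [Multiset.map_cons, Multiset.sum_cons, Multiset.sum_eq_zero, add_zero] at hs
  · have he := h.ends t (by simp)
    rw [if_pos (Finset.mem_coe.1 he.1), if_pos (Finset.mem_coe.1 he.2)] at hs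
    rw [h.par_eq t (by simp)] at ht1
    have key : ∀ a b c d : ZMod 2, 1 + a + b + c + d = 1 → 0 ≠ pm c * pm a + pm d * pm b := by decide
    exact key _ _ _ _ ht1 hs
  · intro n hn
    obtain ⟨r, hr, rfl⟩ := Multiset.mem_map.1 hn
    have he := h.ends r (by simp [hr])
    have hr0 := hR r hr
    rw [h.par_eq r (by simp [hr])] at hr0
    rw [if_pos (Finset.mem_coe.1 he.1), if_pos (Finset.mem_coe.1 he.2)]
    have key : ∀ a b c d : ZMod 2, 1 + a + b + c + d = 0 → pm c * pm a + pm d * pm b = 0 := by decide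
    exact key _ _ _ _ hr0

/-- Frustration is odd and never `1`, hence at least `3`; this is `Tough` with `k = m = 3`.
Elimination down to one vertex leaves loops, at least three of them odd. -/
lemma IsNet.exists_three_odd_of_six_le {G : Graph α β} {neg : β → ZMod 2} {V : Finset α}
    {N : Multiset (FlowEdge α β)} (h : IsNet G neg V N) (hV : V.Nonempty)
    (h6 : ∀ f, Sep V f → 6 ≤ cross N f) :
    ∃ v ∈ V, ∃ l₁ l₂ l₃, (IsWalk G v l₁ v ∧ IsWalk G v l₂ v ∧ IsWalk G v l₃ v) ∧
      ((l₁.map neg).sum = 1 ∧ (l₂.map neg).sum = 1 ∧ (l₃.map neg).sum = 1) ∧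
      (l₁ : Multiset β) + l₂ + l₃ = (N.map fun t => Multiset.ofList t.walk).sum := by
  classical
  obtain ⟨v, hv⟩ := hV
  have hset : ({v} : Set α) ∪ ↑(V.erase v) = V := by
    ext x
    by_cases hx : x = v <;> simp [hx, hv]
  have hcast (f) : (frus (N.map (shape neg ∅)) f : ZMod 2) = 1 := by
    rw [frus_cast, (ZMod.natCast_eq_zero_iff_even).2 (h.even_cross f), add_zero]
    simp only [parAt_empty]
    exact h.odd
  have ht : Tough {v} ({v} ∪ ↑(V.erase v)) 3 3 (N.map (shape neg ∅)) := by
    rw [hset]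
    refine ⟨?_, ?_, ?_, ?_, ?_⟩
    · intro e he
      obtain ⟨t, ht, rfl⟩ := Multiset.mem_map.1 he
      exact h.ends t ht
    · intro f _ hf
      rw [cut_map_shape]; exact h6 f hf
    · intro f _
      have h1 := h.frus_ne_one f
      have h2 := ZMod.natCast_eq_one_iff_odd.1 (hcast f)
      obtain ⟨c, hc⟩ := h2
      omega
    · intro f _; rw [cut_map_shape]; exact h.even_cross f
    · intro f _
      have h2 := ZMod.natCast_eq_one_iff_odd.1 (hcast f)
      exact h2.add_odd (by decide)
  obtain ⟨M', hM', ht'⟩ := ht.exists_red_root (by simp) le_rfl (Set.singleton_nonempty v) _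
    (by simp)
  obtain ⟨N', rfl, hw, hs, -⟩ := exists_red_lift neg (Set.empty_subset _) hM' h.walk
  have hclosed : ∀ t ∈ N', IsWalk G v t.walk v := by
    intro t htN
    have h1 := ht'.ends (shape neg ∅ t) (Multiset.mem_map_of_mem _ htN)
    have h2 := hw t htN
    have h3 : t.src = v := h1.1
    have h4 : t.tgt = v := h1.2
    rwa [h3, h4] at h2
  have hodd : (N'.map (par neg)).sum = 1 := by
    rw [← sum_map_map_neg, hs, sum_map_map_neg, h.odd]
  have h3 := ht'.le_frus 0 fun _ _ _ _ => rfl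
  rw [frus_map_shape] at h3
  simp only [parAt_empty, Pi.zero_apply, add_zero] at h3
  obtain ⟨t₁, N', rfl, ht₁⟩ := exists_cons_of_sum_ne_zero (M := N')
    (F := fun t => (t.par neg).val) (by omega)
  rw [Multiset.map_cons, Multiset.sum_cons] at h3
  have hlt := ZMod.val_lt (t₁.par neg)
  obtain ⟨t₂, N', rfl, ht₂⟩ := exists_cons_of_sum_ne_zero (M := N')
    (F := fun t => (t.par neg).val) (by omega)
  have ht₁ : t₁.par neg = 1 := zmod2_ne_zero fun h => ht₁ (by rw [h]; rfl)
  have ht₂ : t₂.par neg = 1 := zmod2_ne_zero fun h => ht₂ (by rw [h]; rfl)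
  simp only [Multiset.map_cons, Multiset.sum_cons] at hodd hs
  -- Two odd loops are kept and all the others are concatenated. The total parity makes this third
  -- walk odd.
  obtain ⟨l₃, hl₃, hl₃s⟩ := exists_isWalk_join (G := G) (v := v) (N'.map fun t => t.walk) (by
    intro l hl
    obtain ⟨t, ht, rfl⟩ := Multiset.mem_map.1 hl
    exact hclosed t (by simp [ht]))
  rw [Multiset.map_map] at hl₃s
  refine ⟨v, hv, t₁.walk, t₂.walk, l₃, ⟨hclosed t₁ (by simp), hclosed t₂ (by simp), hl₃⟩,
    ⟨ht₁, ht₂, ?_⟩, ?_⟩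
  · rw [ht₁, ht₂, ← sum_map_map_neg] at hodd
    have : ((l₃ : Multiset β).map neg).sum = (l₃.map neg).sum := by simp
    rw [← this, hl₃s]
    have key : ∀ a : ZMod 2, 1 + (1 + a) = 1 → a = 1 := by decide
    exact key _ hodd
  · rw [hl₃s, ← hs, add_assoc]; rfl

end SignedGraph

/-! ### Reduction of nets along cuts of size 2 and 4 -/

namespace SignedGraph

variable {α β : Type*}

open FlowEdge

lemma cross_add (M N : Multiset (FlowEdge α β)) (f : α → ZMod 2) :
    cross (M + N) f = cross M f + cross N f := by simp [cross]

lemma cross_eq_zero {N : Multiset (FlowEdge α β)} {f : α → ZMod 2}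
    (h : ∀ t ∈ N, f t.src = f t.tgt) : cross N f = 0 := by
  refine Multiset.sum_eq_zero fun n hn => ?_
  obtain ⟨t, ht, rfl⟩ := Multiset.mem_map.1 hn
  rw [h t ht, CharTwo.add_self_eq_zero]; rfl

open Classical in
-- Weight the vertices outside `Y` by `pm (g x)` and those in `Y` by `0`. If every edge were
-- consistent, the edges within the far side would contribute `0` and each edge of the cut `-1`, so
-- the size of the cut would vanish modulo 3.
lemma IsNet.frus_ne_zero {G : Graph α β} {neg : β → ZMod 2} {V : Finset α}
    {N : Multiset (FlowEdge α β)} (h : IsNet G neg V N) {f : α → ZMod 2}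
    (hf : (cross N f : ZMod 3) ≠ 0) {g : α → ZMod 2} {Y : Set α}
    (hY : Y = {x | x ∈ V ∧ f x = 0}) (hg : ∀ x ∈ Y, g x = 0) :
    frus ((N.filter fun t => ¬ (f t.src = 0 ∧ f t.tgt = 0)).map (shape neg Y)) g ≠ 0 := by
  intro h0
  rw [frus_map_shape, Multiset.sum_eq_zero_iff] at h0
  have hz : ∀ t ∈ N, ¬ (f t.src = 0 ∧ f t.tgt = 0) →
      t.parAt neg Y + g t.src + g t.tgt = 0 := fun t ht hft =>
    (ZMod.val_eq_zero _).1 (h0 _ (Multiset.mem_map.2 ⟨t, Multiset.mem_filter.2 ⟨ht, hft⟩, rfl⟩))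
  have hs := sum_mul_exc V (fun x => if f x = 0 then 0 else pm (g x)) N
  rw [Finset.sum_eq_zero fun x hx => by rw [h.exc_eq x hx, mul_zero]] at hs
  apply hf
  rw [← neg_eq_zero, cross, Nat.cast_multiset_sum, Multiset.map_map, ← Multiset.sum_map_neg, hs]
  congr 1
  refine Multiset.map_congr rfl fun t ht => ?_
  have he := h.ends t ht
  have hx := hg t.src
  have hy := hg t.tgt
  have hzt := hz t ht
  rw [if_pos (Finset.mem_coe.1 he.1), if_pos (Finset.mem_coe.1 he.2)]
  simp only [parAt, hY, Set.mem_ofPred_eq, Finset.mem_coe.1 he.1, Finset.mem_coe.1 he.2,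
    true_and, h.par_eq t ht, Function.comp] at hx hy hzt ⊢
  generalize f t.src = a, f t.tgt = b, g t.src = c, g t.tgt = d, t.sOut = p, t.tOut = q at *
  clear hs h0 hz he
  revert hx hy hzt
  revert a b c d p q
  decide

lemma sum_map_filter {τ A : Type*} [AddCommMonoid A] (p : τ → Prop) [DecidablePred p] (F : τ → A)
    (M : Multiset τ) : ((M.filter p).map F).sum = (M.map fun t => if p t then F t else 0).sum := by
  induction M using Multiset.induction with
  | empty => simp
  | cons t M ih => by_cases ht : p t <;> simp [ht, ih]

open Classical in
-- An edge inside one side is counted once with its own parity. An edge of the cut is counted from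
-- both sides, with its parity plus `1` in total; as cuts are even, the odd total parity remains. So
-- exactly one side has the parity of any given `k`.
lemma IsNet.sum_parAt {G : Graph α β} {neg : β → ZMod 2} {V : Finset α}
    {N : Multiset (FlowEdge α β)} (h : IsNet G neg V N) (f : α → ZMod 2) :
    ((N.filter fun t => ¬ (f t.src = 0 ∧ f t.tgt = 0)).map
        (parAt neg {x | x ∈ V ∧ f x = 0})).sum +
      ((N.filter fun t => ¬ (f t.src = 1 ∧ f t.tgt = 1)).map
        (parAt neg {x | x ∈ V ∧ f x = 1})).sum = 1 := by
  have h1 : (1 : ZMod 2) = (N.map (par neg)).sum + (cross N f : ℕ) := by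
    rw [(ZMod.natCast_eq_zero_iff_even).2 (h.even_cross f), h.odd, add_zero]
  refine Eq.trans ?_ h1.symm
  rw [cross, sum_parity, ← Multiset.sum_map_add, sum_map_filter, sum_map_filter,
    ← Multiset.sum_map_add]
  congr 1
  refine Multiset.map_congr rfl fun t ht => ?_
  have he := h.ends t ht
  simp only [parAt, Set.mem_ofPred_eq, Finset.mem_coe.1 he.1, Finset.mem_coe.1 he.2, true_and,
    h.par_eq t ht]
  generalize f t.src = a, f t.tgt = b, t.sOut = p, t.tOut = q
  revert a b p q
  decide

open Classical in
/-- One side of a small cut can be reduced to as many odd edges as half the size of the cut. -/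
lemma IsNet.exists_smaller {G : Graph α β} {neg : β → ZMod 2} {V : Finset α}
    {N : Multiset (FlowEdge α β)} (h : IsNet G neg V N) {f : α → ZMod 2} {k : ℕ}
    (hk : k = 1 ∨ k = 2) (hf : Sep V f) (hfk : cross N f = 2 * k)
    (hmin : ∀ g, Sep V g → 2 * k ≤ cross N g)
    (hpar : ((N.filter fun t => ¬ (f t.src = 0 ∧ f t.tgt = 0)).map
        (parAt neg {x | x ∈ V ∧ f x = 0})).sum = k) :
    ∃ N', IsNet G neg ↑(V.filter fun x => f x = 0) N' ∧
      (N'.map fun t => Multiset.ofList t.walk).sum =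
        (N.map fun t => Multiset.ofList t.walk).sum := by
  set Y : Set α := {x | x ∈ V ∧ f x = 0} with hY
  have hYV : Y ∪ ↑(V.filter fun x => ¬ f x = 0) = (V : Set α) := by
    ext x
    by_cases hx : f x = 0 <;> simp [Y, hx]
  set NX := N.filter fun t => ¬ (f t.src = 0 ∧ f t.tgt = 0) with hNX
  set NY := N.filter fun t => f t.src = 0 ∧ f t.tgt = 0 with hNY
  have hN : NY + NX = N := Multiset.filter_add_not _ N
  have hNXN : ∀ t ∈ NX, t ∈ N := fun t ht => (Multiset.mem_filter.1 ht).1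
  have hNYN : ∀ t ∈ NY, t ∈ N := fun t ht => (Multiset.mem_filter.1 ht).1
  have hNYY : ∀ t ∈ NY, t.src ∈ Y ∧ t.tgt ∈ Y := fun t ht => by
    have h1 := h.ends t (hNYN t ht)
    have h2 := (Multiset.mem_filter.1 ht).2
    exact ⟨⟨h1.1, h2.1⟩, ⟨h1.2, h2.2⟩⟩
  have hcrossX : ∀ g, ConstOn Y g → cross NX g = cross N g := by
    intro g hg
    rw [← hN, cross_add, cross_eq_zero (N := NY), zero_add]
    exact fun t ht => hg _ (hNYY t ht).1 _ (hNYY t ht).2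
  have hcast : ∀ g, ConstOn Y g → (frus (NX.map (shape neg Y)) g : ZMod 2) = k := by
    intro g hg
    rw [frus_cast, hpar, hcrossX g hg, (ZMod.natCast_eq_zero_iff_even).2 (h.even_cross g), add_zero]
  have heven : ∀ g, ConstOn Y g → Even (frus (NX.map (shape neg Y)) g + k) := by
    intro g hg
    rw [← ZMod.natCast_eq_zero_iff_even, Nat.cast_add, hcast g hg, CharTwo.add_self_eq_zero]
  obtain ⟨y₀, hy₀⟩ : Y.Nonempty := by
    obtain ⟨x, hx, y, hy, hxy⟩ := hf
    by_cases h0 : f x = 0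
    · exact ⟨x, hx, h0⟩
    · refine ⟨y, hy, zmod2_ne_one fun h1 => hxy ?_⟩
      rw [h1, zmod2_ne_zero h0]
  -- The frustration is nonzero, because `2k` is `2` or `4` and not divisible by 3, and it has the
  -- parity of `k`. For `k ≤ 2` this gives at least `k`.
  have ht : Tough Y (Y ∪ ↑(V.filter fun x => ¬ f x = 0)) k k (NX.map (shape neg Y)) := by
    rw [hYV]
    refine ⟨?_, ?_, ?_, ?_, heven⟩
    · intro e he
      obtain ⟨t, ht, rfl⟩ := Multiset.mem_map.1 he
      exact h.ends t (hNXN t ht)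
    · intro g hg hs
      rw [cut_map_shape, hcrossX g hg]; exact hmin g hs
    · intro g hg
      have hne : frus (NX.map (shape neg Y)) g ≠ 0 := by
        have hf3 : (cross N f : ZMod 3) ≠ 0 := by
          rw [hfk]
          rcases hk with rfl | rfl <;> decide
        rcases zmod2_cases (g y₀) with h0 | h1
        · exact h.frus_ne_zero hf3 hY fun x hx => (hg x hx y₀ hy₀).trans h0
        · rw [← frus_compl]
          refine h.frus_ne_zero hf3 hY fun x hx => ?_
          rw [Pi.add_apply, hg x hx y₀ hy₀, h1]; rfl
      obtain ⟨c, hc⟩ := heven g hg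
      rcases hk with rfl | rfl <;> omega
    · intro g hg
      rw [cut_map_shape, hcrossX g hg]; exact h.even_cross g
  obtain ⟨M', hM', ht'⟩ := ht.exists_red_root (by rcases hk with rfl | rfl <;> simp) le_rfl
    ⟨y₀, hy₀⟩ _ (by
      rw [Set.disjoint_left]
      intro x hx hx'
      exact (Finset.mem_filter.1 (Finset.mem_coe.1 hx')).2 hx.2)
  have hcutM : ∀ g, ((cross NX g : ℕ) : ZMod 2) = cut M' g := by
    intro g
    rw [← cut_map_shape neg Y]; exact hM'.cut_eq g
  obtain ⟨N', rfl, hw, hs, hexc⟩ := exists_red_lift neg le_rfl hM' fun t ht => h.walk t (hNXN t ht)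
  have hN'Y : ∀ t ∈ N', t.src ∈ Y ∧ t.tgt ∈ Y := fun t ht =>
    ht'.ends (shape neg Y t) (Multiset.mem_map_of_mem _ ht)
  -- Splitting off preserves the number of ends in `Y`. Each of the `2k` cut edges has one, and each
  -- remaining edge has two.
  have hcard : Multiset.card N' = k := by
    have h1 := hM'.endsIn_eq
    have h2 : endsIn Y (NX.map (shape neg Y)) = cross N f := by
      rw [← hcrossX f fun x hx y hy => hx.2.trans hy.2.symm, endsIn, Multiset.map_map, cross]
      congr 1
      refine Multiset.map_congr rfl fun t ht => ?_
      have h3 := h.ends t (hNXN t ht)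
      have h4 := (Multiset.mem_filter.1 ht).2
      simp only [Function.comp, shape, Set.indicator, hY, Set.mem_ofPred_eq,
        Finset.mem_coe.1 h3.1, Finset.mem_coe.1 h3.2, true_and, Pi.one_apply]
      generalize f t.src = a, f t.tgt = b at *
      clear h1 h3
      revert h4 a b
      decide
    have h5 : endsIn Y (N'.map (shape neg Y)) = 2 * Multiset.card N' := by
      rw [endsIn, Multiset.map_map, Multiset.map_congr (g := fun _ => 2) rfl]
      · rw [Multiset.map_const', Multiset.sum_replicate, smul_eq_mul, mul_comm]
      · intro t ht
        change Y.indicator 1 t.src + Y.indicator 1 t.tgt = 2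
        rw [Set.indicator_of_mem (hN'Y t ht).1, Set.indicator_of_mem (hN'Y t ht).2]
        rfl
    omega
  -- There are `k` edges, of which at least `k` are odd in the switched sense, so all are. Oddness
  -- after switching at both ends says precisely that the sign of the walk fits its end directions.
  have hpar' : ∀ t ∈ N', t.par neg = 1 + t.sOut + t.tOut := by
    intro t ht
    have h1 : t.parAt neg Y = 1 := by
      by_contra hne
      have h2 := ht'.le_frus 0 fun _ _ _ _ => rfl
      rw [frus_map_shape] at h2
      obtain ⟨R, rfl⟩ := Multiset.exists_cons_of_mem ht
      rw [Multiset.map_cons, Multiset.sum_cons, zmod2_ne_one hne] at h2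
      have h3 : (R.map fun t => (t.parAt neg Y + (0 : α → ZMod 2) t.src +
          (0 : α → ZMod 2) t.tgt).val).sum ≤ Multiset.card R • 1 := by
        refine (Multiset.sum_le_card_nsmul _ 1 ?_).trans_eq (by rw [Multiset.card_map])
        intro n hn
        obtain ⟨t, -, rfl⟩ := Multiset.mem_map.1 hn
        exact Nat.le_of_lt_succ (ZMod.val_lt _)
      rw [Multiset.card_cons] at hcard
      simp only [Pi.zero_apply, add_zero, ZMod.val_zero, smul_eq_mul, mul_one] at h2 h3
      omega
    rw [parAt, if_pos (hN'Y t ht).1, if_pos (hN'Y t ht).2] at h1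
    have key : ∀ a b c : ZMod 2, a + (b + c) = 1 → a = 1 + b + c := by decide
    exact key _ _ _ h1
  have hsum : ((NY + N').map fun t => Multiset.ofList t.walk).sum =
      (N.map fun t => Multiset.ofList t.walk).sum := by
    rw [Multiset.map_add, Multiset.sum_add, hs, ← Multiset.sum_add, ← Multiset.map_add, hN]
  have hYset : (↑(V.filter fun x => f x = 0) : Set α) = Y := by
    ext x; simp [Y]
  refine ⟨NY + N', ?_, hsum⟩
  rw [hYset]
  refine ⟨?_, ?_, ?_, ?_, ?_, ?_, ?_⟩
  · intro t ht
    rcases Multiset.mem_add.1 ht with ht | ht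
    exacts [hNYY t ht, hN'Y t ht]
  · intro t ht
    rcases Multiset.mem_add.1 ht with ht | ht
    exacts [h.walk t (hNYN t ht), hw t ht]
  · intro t ht
    rcases Multiset.mem_add.1 ht with ht | ht
    exacts [h.par_eq t (hNYN t ht), hpar' t ht]
  · intro g
    have h1 := h.even_cross g
    rw [← ZMod.natCast_eq_zero_iff_even, ← hN, cross_add, Nat.cast_add, hcutM g, cut_map_shape,
      ← Nat.cast_add, ← cross_add] at h1
    exact (ZMod.natCast_eq_zero_iff_even).1 h1
  · rintro g ⟨x, hx, y, hy, hxy⟩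
    by_contra hlt
    have h0 : cross NY g = 0 := by rw [cross_add] at hlt; omega
    obtain ⟨z, hz, hz1⟩ : ∃ z ∈ V, f z ≠ 0 := by
      by_contra hno
      push Not at hno
      obtain ⟨x, hx, y, hy, hxy⟩ := hf
      exact hxy ((hno x hx).trans (hno y hy).symm)
    -- If no inner edge crossed `g`, the two classes of `g` in `Y` would give two cuts of `N` that
    -- partition the `2k` edges of `f`. By minimality each has at least `2k` edges.
    have hsep : ∀ c : ZMod 2, 2 * k ≤ cross N fun x => if f x = 0 then g x + c else 0 := by
      intro c
      refine hmin _ ?_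
      have : ∃ w ∈ Y, g w + c = 1 := by
        have key : ∀ a b c : ZMod 2, a ≠ b → a + c = 1 ∨ b + c = 1 := by decide
        rcases key _ _ c hxy with h | h
        exacts [⟨x, hx, h⟩, ⟨y, hy, h⟩]
      obtain ⟨w, hw, hw1⟩ := this
      refine ⟨w, hw.1, z, hz, ?_⟩
      simp only [if_pos hw.2, hw1, if_neg hz1]
      decide
    have hle : (cross N fun x => if f x = 0 then g x + 0 else 0) +
        (cross N fun x => if f x = 0 then g x + 1 else 0) ≤ cross N f + 2 * cross NY g := by
      rw [hNY, cross, cross, cross, cross, sum_map_filter, ← Multiset.sum_map_mul_left,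
        ← Multiset.sum_map_add, ← Multiset.sum_map_add]
      refine sum_map_le_of_le _ _ _ fun t _ => ?_
      generalize f t.src = a, f t.tgt = b, g t.src = c, g t.tgt = d
      revert a b c d
      decide
    have := hsep 0
    have := hsep 1
    rcases hk with rfl | rfl <;> omega
  · intro x hx
    rw [Multiset.map_add, Multiset.sum_add, hexc x hx, ← Multiset.sum_add, ← Multiset.map_add, hN]
    exact h.exc_eq x hx.1
  · rw [← sum_map_map_neg, hsum, sum_map_map_neg, h.odd]

lemma exists_minimal_cross (N : Multiset (FlowEdge α β)) (P : (α → ZMod 2) → Prop)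
    (h : ∃ f, P f) : ∃ f, P f ∧ ∀ g, P g → cross N f ≤ cross N g := by
  obtain ⟨f, hf, hmin⟩ := WellFounded.has_min (measure (cross N)).wf {f | P f} h
  exact ⟨f, hf, fun g hg => not_lt.1 (hmin g hg)⟩

/-- Induction on the number of vertices. A smallest cut with fewer than 6 edges has 2 or 4, and the
side to keep is chosen by parity. The walks of the smaller net use the same edges of `G`. -/
theorem IsNet.exists_three_odd {G : Graph α β} {neg : β → ZMod 2} {V : Finset α}
    {N : Multiset (FlowEdge α β)} (h : IsNet G neg V N) (hV : V.Nonempty) :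
    ∃ v ∈ V, ∃ l₁ l₂ l₃, (IsWalk G v l₁ v ∧ IsWalk G v l₂ v ∧ IsWalk G v l₃ v) ∧
      ((l₁.map neg).sum = 1 ∧ (l₂.map neg).sum = 1 ∧ (l₃.map neg).sum = 1) ∧
      (l₁ : Multiset β) + l₂ + l₃ = (N.map fun t => Multiset.ofList t.walk).sum := by
  classical
  induction hn : V.card using Nat.strong_induction_on generalizing V N with
  | _ n ih =>
  by_cases h6 : ∀ f, Sep V f → 6 ≤ cross N f
  · exact h.exists_three_odd_of_six_le hV h6
  push Not at h6
  obtain ⟨f, ⟨hf, hf6⟩, hmin⟩ := exists_minimal_cross N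
    (fun f : α → ZMod 2 => Sep (V : Set α) f ∧ cross N f < 6) h6
  have hmin' : ∀ g, Sep V g → cross N f ≤ cross N g := by
    intro g hg
    by_contra hlt
    exact hlt (hmin g ⟨hg, by omega⟩)
  obtain ⟨k, hk⟩ := h.even_cross f
  have h1 := h.one_le_cross f hf
  have hk12 : k = 1 ∨ k = 2 := by omega
  suffices H : ∃ f : α → ZMod 2, Sep V f ∧ cross N f = 2 * k ∧
      (∀ g, Sep V g → 2 * k ≤ cross N g) ∧
      ((N.filter fun t => ¬ (f t.src = 0 ∧ f t.tgt = 0)).map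
        (parAt neg {x | x ∈ V ∧ f x = 0})).sum = k by
    obtain ⟨f, hf, hfk, hfm, hpar⟩ := H
    obtain ⟨N', hN', hs⟩ := h.exists_smaller hk12 hf hfk hfm hpar
    obtain ⟨x, hx, y, hy, hxy⟩ := hf
    have hlt : (V.filter fun x => f x = 0).card < V.card := by
      refine Finset.card_lt_card (Finset.filter_ssubset.2 ?_)
      by_contra hno
      push Not at hno
      exact hxy ((hno x hx).trans (hno y hy).symm)
    have hne : (V.filter fun x => f x = 0).Nonempty := by
      by_cases h0 : f x = 0
      · exact ⟨x, Finset.mem_filter.2 ⟨hx, h0⟩⟩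
      · refine ⟨y, Finset.mem_filter.2 ⟨hy, zmod2_ne_one fun h1 => hxy ?_⟩⟩
        rw [h1, zmod2_ne_zero h0]
    obtain ⟨v, hv, hl⟩ := ih _ (hn ▸ hlt) hN' hne rfl
    rw [hs] at hl
    exact ⟨v, (Finset.mem_filter.1 hv).1, hl⟩
  by_cases hpar : ((N.filter fun t => ¬ (f t.src = 0 ∧ f t.tgt = 0)).map
        (parAt neg {x | x ∈ V ∧ f x = 0})).sum = k
  · exact ⟨f, hf, by omega, fun g hg => by have := hmin' g hg; omega, hpar⟩
  · have hc : ∀ a : ZMod 2, a + 1 = 0 ↔ a = 1 := by decide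
    have hcross : cross N (f + 1) = cross N f := by
      rw [← cut_map_shape neg ∅, cut_compl, cut_map_shape]
    refine ⟨f + 1, ?_, by omega, fun g hg => by have := hmin' g hg; omega, ?_⟩
    · obtain ⟨x, hx, y, hy, hxy⟩ := hf
      exact ⟨x, hx, y, hy, fun h => hxy (add_right_cancel h)⟩
    -- The two sides have different parities, so if this one is wrong, the complementary one is
    -- right.
    · have hs := h.sum_parAt f
      simp only [Pi.add_apply, Pi.one_apply, hc]
      have key : ∀ a b c : ZMod 2, a ≠ c → a + b = 1 → b = c := by decide
      exact key _ _ _ hpar hs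

end SignedGraph

namespace SignedGraph

variable {α β : Type*}

/-! ### Signs -/

/-- The parity of an edge: `1` if it is negative. -/
def negParity (σ : β → ℤˣ) (e : β) : ZMod 2 := if σ e = 1 then 0 else 1

lemma sum_negParity (σ : β → ℤˣ) (S : Finset β) :
    ∑ e ∈ S, negParity σ e = ({e | e ∈ S ∧ σ e = -1}.ncard : ℕ) := by
  classical
  have h : {e | e ∈ S ∧ σ e = -1} = ↑(S.filter fun e => σ e = -1) := by ext; simp
  rw [h, Set.ncard_coe_finset, Finset.card_filter, Nat.cast_sum]
  refine Finset.sum_congr rfl fun e _ => ?_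
  rcases Int.units_eq_one_or (σ e) with h | h <;> rw [negParity, h] <;> decide

lemma odd_numNegative_iff {G : Graph α β} (σ : β → ℤˣ) (S : Finset β) (hS : E(G) = S) :
    Odd (numNegative G σ) ↔ ∑ e ∈ S, negParity σ e = 1 := by
  rw [sum_negParity, ZMod.natCast_eq_one_iff_odd, numNegative, hS]
  rfl

lemma even_numNegative_iff {G : Graph α β} (σ : β → ℤˣ) (S : Finset β) (hS : E(G) = S) :
    Even (numNegative G σ) ↔ ∑ e ∈ S, negParity σ e = 0 := by
  rw [sum_negParity, ZMod.natCast_eq_zero_iff_even, numNegative, hS]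
  rfl

lemma prod_eq_one_iff (σ : β → ℤˣ) (S : Finset β) :
    ∏ e ∈ S, σ e = 1 ↔ ∑ e ∈ S, negParity σ e = 0 := by
  classical
  suffices H : ∏ e ∈ S, σ e = if ∑ e ∈ S, negParity σ e = 0 then 1 else -1 by
    rw [H]
    split_ifs with h <;> simp [h]
  induction S using Finset.induction_on with
  | empty => simp
  | insert e S he ih =>
    rw [Finset.prod_insert he, Finset.sum_insert he, ih]
    generalize ∑ e ∈ S, negParity σ e = a
    rcases Int.units_eq_one_or (σ e) with h | h <;> rw [negParity, h] <;> revert a <;> decide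

lemma sign_eq_one_iff {G : Graph α β} (σ : β → ℤˣ) (S : Finset β) (hS : E(G) = S) :
    sign G σ = 1 ↔ ∑ e ∈ S, negParity σ e = 0 := by
  rw [sign, hS, finprod_mem_coe_finset, prod_eq_one_iff]

/-- Multiplication by `1` or `-1`, according to parity. -/
def sgn {A : Type*} [AddCommGroup A] (s : ZMod 2) : A →+ A :=
  if s = 0 then AddMonoidHom.id A else -AddMonoidHom.id A

section
variable {A : Type*} [AddCommGroup A]

lemma sgn_zero (x : A) : sgn 0 x = x := by simp [sgn]

lemma sgn_one (x : A) : sgn 1 x = -x := by simp [sgn]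

lemma sgn_sgn (s t : ZMod 2) (x : A) : sgn s (sgn t x) = sgn (s + t) x := by
  rcases zmod2_cases s with rfl | rfl <;> rcases zmod2_cases t with rfl | rfl <;>
    simp [sgn_zero, sgn_one, show (1 : ZMod 2) + 1 = 0 by decide]

lemma sgn_one_add (s : ZMod 2) (x : A) : sgn (1 + s) x = -sgn s x := by
  rw [← sgn_sgn, sgn_one]

lemma sgn_eq_or (s : ZMod 2) (x : A) : sgn s x = x ∨ sgn s x = -x := by
  rcases zmod2_cases s with rfl | rfl
  exacts [.inl (sgn_zero x), .inr (sgn_one x)]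

lemma sgn_eq_zero {s : ZMod 2} {x : A} : sgn s x = 0 ↔ x = 0 := by
  rcases sgn_eq_or s x with h | h <;> simp [h]

end

/-! ### Flows -/

/-- The end-vertices and directions of the half-edges of an oriented signed graph; the direction
is `0` for a half-edge that is directed out of its end-vertex. -/
structure Frame (G : Graph α β) (neg : β → ZMod 2) where
  src : β → α
  tgt : β → α
  sOut : β → ZMod 2
  tOut : β → ZMod 2
  isLink : ∀ e ∈ E(G), G.IsLink e (src e) (tgt e)
  par_eq : ∀ e ∈ E(G), neg e = 1 + sOut e + tOut e

section
variable {A : Type*} [AddCommGroup A] {G : Graph α β} {neg : β → ZMod 2}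

open Classical in
/-- The contribution of an edge to the boundary at a vertex. -/
noncomputable def Frame.con (P : Frame G neg) (z : α) (e : β) (y : A) : A :=
  (if P.src e = z then sgn (P.sOut e) y else 0) + (if P.tgt e = z then sgn (P.tOut e) y else 0)

lemma Frame.con_add (P : Frame G neg) (z : α) (e : β) (x y : A) :
    P.con z e (x + y) = P.con z e x + P.con z e y := by
  unfold Frame.con
  split_ifs <;> simp [map_add] ; abel

lemma Frame.con_zero (P : Frame G neg) (z : α) (e : β) : P.con z e (0 : A) = 0 := by
  unfold Frame.con
  split_ifs <;> simp

/-- Turns the orientation into functions on all of `β`, with arbitrary values off `E(G)`, so that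
Kirchhoff's law becomes a finite sum over edges. -/
lemma exists_frame {σ : β → ℤˣ} (D : Orientation G σ) [Nonempty α] (S : Finset β)
    (hS : E(G) = S) : ∃ P : Frame G (negParity σ), ∀ (A : Type*) [AddCommGroup A] (ξ : β → A),
      D.IsFlow (fun e => ξ e) ↔ ∀ z ∈ V(G), ∑ e ∈ S, P.con z e (ξ e) = 0 := by
  classical
  let b : Bool → ZMod 2 := fun c => if c then 0 else 1
  refine ⟨⟨fun e => if h : e ∈ E(G) then D.vert ⟨e, h⟩ false else Classical.arbitrary α,
    fun e => if h : e ∈ E(G) then D.vert ⟨e, h⟩ true else Classical.arbitrary α,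
    fun e => if h : e ∈ E(G) then b (D.out ⟨e, h⟩ false) else 0,
    fun e => if h : e ∈ E(G) then b (D.out ⟨e, h⟩ true) else 0, ?_, ?_⟩, ?_⟩
  · intro e he
    simpa only [dif_pos he] using D.isLink_vert ⟨e, he⟩
  · intro e he
    have h := D.compatible ⟨e, he⟩
    simp only [dif_pos he, negParity, ← h]
    generalize D.out ⟨e, he⟩ false = c, D.out ⟨e, he⟩ true = d
    revert c d
    decide
  · intro A _ ξ
    refine forall₂_congr fun z _ => ?_
    have : Fintype E(G) := by rw [hS]; exact S.fintypeCoeSort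
    have hsum : ∀ F : β → A, ∑ e ∈ S, F e = ∑ e : E(G), F e := by
      intro F
      rw [← Finset.sum_coe_sort]
      exact Fintype.sum_equiv (Equiv.setCongr hS.symm) _ _ fun _ => rfl
    have hfin : ∀ T : Set (E(G) × Bool), (∑ᶠ h ∈ T, ξ h.1) =
        ∑ e : E(G), ((if (e, false) ∈ T then ξ e else 0) + (if (e, true) ∈ T then ξ e else 0)) := by
      intro T
      rw [finsum_mem_def, finsum_eq_sum_of_fintype, Fintype.sum_prod_type]
      refine Finset.sum_congr rfl fun e _ => ?_
      rw [Fintype.sum_bool, add_comm]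
      simp only [Set.indicator]
    rw [hsum, hfin, hfin, ← Finset.sum_sub_distrib]
    refine Eq.congr (Finset.sum_congr rfl fun e _ => ?_) rfl
    simp only [Frame.con, dif_pos e.2, Orientation.outAt, Orientation.inAt, Set.mem_ofPred_eq, b,
      Subtype.coe_eta]
    by_cases h1 : D.vert e false = z <;> by_cases h2 : D.vert e true = z <;>
      rcases Bool.eq_false_or_eq_true (D.out e false) with h3 | h3 <;>
      rcases Bool.eq_false_or_eq_true (D.out e true) with h4 | h4 <;>
      simp [h1, h2, h3, h4, sgn_zero, sgn_one, sub_eq_add_neg]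

lemma IsWalk.exists_index {x y : α} {l : List β} (h : IsWalk G x l y) :
    ∃ v : ℕ → α, v 0 = x ∧ v l.length = y ∧
      ∀ i (hi : i < l.length), G.IsLink l[i] (v i) (v (i + 1)) := by
  induction h with
  | nil x => exact ⟨fun _ => x, rfl, rfl, by simp⟩
  | @cons e x y z l h _ ih =>
    obtain ⟨v, h0, h1, h2⟩ := ih
    refine ⟨fun i => if i = 0 then x else v (i - 1), rfl, by simpa using h1, ?_⟩
    rintro (_ | i) hi
    · simpa [h0] using h
    · simpa using h2 i (by simpa using hi)

lemma isWalk_of_index {l : List β} {v : ℕ → α}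
    (h : ∀ i (hi : i < l.length), G.IsLink l[i] (v i) (v (i + 1))) :
    IsWalk G (v 0) l (v l.length) := by
  induction l generalizing v with
  | nil => exact .nil _
  | cons e l ih =>
    refine .cons (h 0 (by simp)) ?_
    refine ih (v := fun i => v (i + 1)) fun i hi => ?_
    have := h (i + 1) (by simpa using hi)
    rwa [List.getElem_cons_succ] at this

open Classical in
/-- A value at the `i`-th vertex of a walk, with the sign of the walk up to there. -/
noncomputable def signedAt (v : ℕ → α) (s : ℕ → ZMod 2) (z : α) (i : ℕ) (y : A) : A :=
  if v i = z then sgn (s i) y else 0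

/-- With the right sign, an edge traversed from `x` to `w` contributes the signed value at `x` minus
that at `w`, where the sign is updated by the edge. Along a walk such terms telescope. -/
lemma Frame.exists_con_eq (P : Frame G neg) {e : β} {x w : α} (h : G.IsLink e x w) (u : ZMod 2) :
    ∃ c : ZMod 2, ∀ (z : α) (y : A), P.con z e (sgn c y) =
      signedAt (fun _ => x) (fun _ => u) z 0 y -
        signedAt (fun _ => w) (fun _ => u + neg e) z 0 y := by
  have hp := P.par_eq e h.edge_mem
  have h1 : ∀ a b : ZMod 2, a + (a + b) = b := by decide
  have h2 : ∀ a b u : ZMod 2, u + (1 + a + b) = 1 + (b + (a + u)) := by decide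
  have h3 : ∀ a b u : ZMod 2, u + (1 + a + b) = 1 + (a + (b + u)) := by decide
  rcases (P.isLink e h.edge_mem).eq_and_eq_or_eq_and_eq h with ⟨rfl, rfl⟩ | ⟨rfl, rfl⟩
  · refine ⟨P.sOut e + u, fun z y => ?_⟩
    simp only [Frame.con, signedAt, sgn_sgn, h1, hp, h2, sgn_one_add]
    split_ifs <;> simp
  · refine ⟨P.tOut e + u, fun z y => ?_⟩
    simp only [Frame.con, signedAt, sgn_sgn, h1, hp, h3, sgn_one_add]
    split_ifs <;> simp [add_comm]

/-- The parity of a walk up to the `i`-th vertex. -/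
def parUpTo (neg : β → ZMod 2) (l : List β) (i : ℕ) : ZMod 2 := ((l.take i).map neg).sum

lemma parUpTo_zero (l : List β) : parUpTo neg l 0 = 0 := rfl

lemma parUpTo_length (l : List β) : parUpTo neg l l.length = (l.map neg).sum := by
  rw [parUpTo, List.take_length]

lemma parUpTo_succ (l : List β) (i : ℕ) (hi : i < l.length) :
    parUpTo neg l (i + 1) = parUpTo neg l i + neg l[i] := by
  rw [parUpTo, List.take_succ_eq_append_getElem hi, List.map_append, List.sum_append, parUpTo]
  simp

/-- Values on the edges of a trail and their boundary. -/
lemma Frame.exists_trail_values (P : Frame G neg) {l : List β} (hl : l.Nodup) {v : ℕ → α}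
    (hv : ∀ i (hi : i < l.length), G.IsLink l[i] (v i) (v (i + 1))) [DecidableEq β] (Y : ℕ → A) :
    ∃ ξ : β → A, (∀ i (hi : i < l.length), ξ l[i] = Y i ∨ ξ l[i] = -Y i) ∧ (∀ e, e ∉ l → ξ e = 0) ∧
      ∀ z, ∑ e ∈ l.toFinset, P.con z e (ξ e) = ∑ i ∈ Finset.range l.length,
        (signedAt v (parUpTo neg l) z i (Y i) - signedAt v (parUpTo neg l) z (i + 1) (Y i)) := by
  have h : ∀ i, ∃ c : ZMod 2, i < l.length → ∀ z, ∀ (hi : i < l.length) (y : A),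
      P.con z l[i] (sgn c y) =
      signedAt v (parUpTo neg l) z i y - signedAt v (parUpTo neg l) z (i + 1) y := by
    intro i
    by_cases hi : i < l.length
    · obtain ⟨c, hc⟩ := P.exists_con_eq (A := A) (hv i hi) (parUpTo neg l i)
      refine ⟨c, fun _ z _ y => ?_⟩
      rw [hc z y]
      simp only [signedAt, parUpTo_succ l i hi]
    · exact ⟨0, fun h => absurd h hi⟩
  choose c hc using h
  have hidx : ∀ i (hi : i < l.length), l.idxOf l[i] = i := fun i hi => hl.idxOf_getElem i hi
  refine ⟨fun e => if e ∈ l then sgn (c (l.idxOf e)) (Y (l.idxOf e)) else 0, ?_, ?_, ?_⟩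
  · intro i hi
    simp only [List.getElem_mem, if_true, hidx i hi]
    exact sgn_eq_or _ _
  · intro e he
    simp [he]
  · intro z
    rw [List.sum_toFinset _ hl, Finset.sum_range, ← List.sum_ofFn]
    congr 1
    refine List.ext_getElem (by simp) fun i hi hi' => ?_
    have hi : i < l.length := by simpa using hi
    simp only [List.getElem_map, List.getElem_ofFn, List.getElem_mem, if_true, hidx i hi]
    exact hc i hi z hi (Y i)

/-- The values `±a` along a closed trail. -/
lemma Frame.exists_trail_flow (P : Frame G neg) {l : List β} (hl : l.Nodup) {x : α}
    (h : IsWalk G x l x) [DecidableEq β] [DecidableEq α] (a : A) :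
    ∃ ξ : β → A, (∀ e ∈ l, ξ e = a ∨ ξ e = -a) ∧ (∀ e, e ∉ l → ξ e = 0) ∧
      ∀ z, ∑ e ∈ l.toFinset, P.con z e (ξ e) =
        if x = z then a - sgn ((l.map neg).sum) a else 0 := by
  obtain ⟨v, h0, h1, hv⟩ := h.exists_index
  obtain ⟨ξ, h2, h3, h4⟩ := P.exists_trail_values hl hv fun _ => a
  refine ⟨ξ, fun e he => ?_, h3, fun z => ?_⟩
  · obtain ⟨i, hi, rfl⟩ := List.mem_iff_getElem.1 he
    exact h2 i hi
  -- The sum telescopes; only the start and the end remain, both at `x`. The defect is `0` for an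
  -- even trail and `2a` for an odd one.
  · rw [h4, Finset.sum_range_sub', signedAt, signedAt, h0, h1, parUpTo_zero, parUpTo_length]
    split_ifs <;> simp [sgn_zero]

end

end SignedGraph

/-! ### Constant flows, flows along trails, and triply odd graphs -/

namespace SignedGraph

variable {α β : Type*}

section
variable {A : Type*} [AddCommGroup A] {G : Graph α β} {neg : β → ZMod 2}

lemma Frame.sum_con_of_two_nsmul (P : Frame G neg) (hG : IsEulerian G) (S : Finset β)
    (hS : E(G) = S) {a : A} (ha : a + a = 0) (z : α) (hz : z ∈ V(G)) :
    ∑ e ∈ S, P.con z e a = 0 := by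
  classical
  have hs : ∀ s : ZMod 2, sgn s a = a := fun s => by
    rcases sgn_eq_or s a with h | h
    · exact h
    · rw [h, neg_eq_iff_add_eq_zero, ha]
  have h : ∀ e ∈ S, P.con z e a = halves G z e • a := fun e he => by
    rw [halves_eq (P.isLink e (by rw [hS]; exact he)), Frame.con, hs, hs]
    split_ifs <;> simp [two_nsmul]
  rw [Finset.sum_congr rfl h, ← Finset.sum_smul, ← valency_eq_sum S hS]
  obtain ⟨c, hc⟩ := hG.2 z hz
  rw [hc, ← two_mul, mul_comm, mul_smul, two_nsmul, ha, smul_zero]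

lemma toFinset_eq [DecidableEq β] {l : List β} {S : Finset β} (hS : E(G) = S)
    (hl : ∀ e, e ∈ l ↔ e ∈ E(G)) : l.toFinset = S := by
  ext e
  rw [List.mem_toFinset, hl, hS, Finset.mem_coe]

lemma sum_map_eq_sum [DecidableEq β] {M : Type*} [AddCommMonoid M] {l : List β} (hl : l.Nodup)
    {S : Finset β} (hS : l.toFinset = S) (F : β → M) : (l.map F).sum = ∑ e ∈ S, F e := by
  rw [← hS, List.sum_toFinset _ hl]

lemma Frame.exists_flow_of_even (P : Frame G neg) (hG : IsEulerian G) (hV : V(G).Finite)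
    (S : Finset β) (hS : E(G) = S) (hneg : ∑ e ∈ S, neg e = 0) (a : A) :
    ∃ ξ : β → A, (∀ e ∈ S, ξ e = a ∨ ξ e = -a) ∧ ∀ z, ∑ e ∈ S, P.con z e (ξ e) = 0 := by
  classical
  obtain ⟨x, hx⟩ := hG.1.1
  obtain ⟨l, h1, h2, h3⟩ := hG.exists_trail hV (by rw [hS]; exact S.finite_toSet) hx
  obtain ⟨ξ, h4, -, h5⟩ := P.exists_trail_flow h2 h1 a
  have hlS := toFinset_eq hS h3
  refine ⟨ξ, fun e he => h4 e (by rwa [← List.mem_toFinset, hlS]), fun z => ?_⟩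
  rw [← hlS, h5, sum_map_eq_sum h2 hlS, hneg, sgn_zero]
  simp

/-- Each of the three odd trails based at `v` has defect `2a` there, and `6a = 0`. -/
lemma Frame.exists_flow_of_isTriplyOdd {σ : β → ℤˣ} (P : Frame G (negParity σ)) (hV : V(G).Finite)
    (S : Finset β) (hS : E(G) = S) (hT : IsTriplyOdd G σ) {a : A} (ha : 3 • a = 0) :
    ∃ ξ : β → A, (∀ e ∈ S, ξ e = a ∨ ξ e = -a) ∧ ∀ z, ∑ e ∈ S, P.con z e (ξ e) = 0 := by
  classical
  obtain ⟨H, h1, hdisj, hun, v, hv⟩ := hT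
  have hfin : ∀ i, E(H i).Finite := fun i =>
    (S.finite_toSet).subset (by rw [← hS]; exact (h1 i).1.edgeSet_mono)
  have h2 : ∀ i, ∃ l, IsWalk (H i) v l v ∧ l.Nodup ∧ ∀ e, e ∈ l ↔ e ∈ E(H i) := fun i =>
    (h1 i).2.1.exists_trail (hV.subset (h1 i).1.vertexSet_mono) (hfin i) (hv i)
  choose l hw hl hm using h2
  choose ξ h4 h5 h6 using fun i => P.exists_trail_flow (hl i) ((hw i).mono (h1 i).1) a
  have hlS : ∀ i, (l i).toFinset ⊆ S := fun i e he => by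
    rw [List.mem_toFinset, hm] at he
    rw [← Finset.mem_coe, ← hS]
    exact (h1 i).1.edgeSet_mono he
  have hval : ∀ i, ∀ e ∈ l i, ∑ j, ξ j e = ξ i e := by
    intro i e he
    refine Finset.sum_eq_single i (fun j _ hj => h5 j e fun hej => ?_) (by simp)
    exact (Set.disjoint_left.1 (hdisj j i hj)) ((hm j e).1 hej) ((hm i e).1 he)
  have hcon : ∀ z e, P.con z e (∑ j, ξ j e) = ∑ j, P.con z e (ξ j e) := by
    intro z e
    simp only [Fin.sum_univ_three, Frame.con_add]
  refine ⟨fun e => ∑ i, ξ i e, fun e he => ?_, fun z => ?_⟩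
  · rw [← Finset.mem_coe, ← hS, ← hun, Set.mem_iUnion] at he
    obtain ⟨i, hi⟩ := he
    rw [← hm] at hi
    simp only [hval i e hi]
    exact h4 i e hi
  · simp only [hcon]
    rw [Finset.sum_comm]
    have h7 : ∀ j, ∑ e ∈ S, P.con z e (ξ j e) = if v = z then a + a else 0 := by
      intro j
      rw [← Finset.sum_subset (hlS j), h6 j z]
      · have h8 : ((l j).map (negParity σ)).sum = 1 := by
          have h9 : E(H j) = (hfin j).toFinset := by simp
          rw [sum_map_eq_sum (hl j) (toFinset_eq h9 (hm j)), ← odd_numNegative_iff σ _ h9]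
          exact (h1 j).2.2
        rw [h8, sgn_one, sub_neg_eq_add]
      · intro e _ he
        rw [h5 j e fun h => he (List.mem_toFinset.2 h), Frame.con_zero]
    simp only [h7, Fin.sum_univ_three]
    split_ifs
    · have : a + a + (a + a) + (a + a) = 3 • a + 3 • a := by abel
      rw [this, ha, add_zero]
    · simp

lemma Frame.isTriplyOdd_of_flow {σ : β → ℤˣ} (P : Frame G (negParity σ)) (hG : IsEulerian G)
    (hV : V(G).Finite) (S : Finset β) (hS : E(G) = S) (hodd : ∑ e ∈ S, negParity σ e = 1)
    (ξ : β → ZMod 3) (hξ : ∀ e ∈ S, ξ e ≠ 0) (hflow : ∀ z ∈ V(G), ∑ e ∈ S, P.con z e (ξ e) = 0) :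
    IsTriplyOdd G σ := by
  classical
  have hr : ∀ e, ∃ r : ZMod 2, e ∈ S → ξ e = pm r := by
    intro e
    by_cases he : e ∈ S
    · have key : ∀ x : ZMod 3, x ≠ 0 → ∃ r, x = pm r := by decide
      obtain ⟨r, hr⟩ := key _ (hξ e he)
      exact ⟨r, fun _ => hr⟩
    · exact ⟨0, fun h => absurd h he⟩
  choose r hr using hr
  have hlink : ∀ e ∈ S, G.IsLink e (P.src e) (P.tgt e) := fun e he =>
    P.isLink e (by rw [hS]; exact he)
  -- An edge of value `-1` has both half-edges reversed. All values become `1`, and the relation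
  -- between sign and directions persists.
  let N : Multiset (FlowEdge α β) :=
    S.val.map fun e => ⟨P.src e, P.sOut e + r e, P.tgt e, P.tOut e + r e, [e]⟩
  have hsum : (N.map fun t => Multiset.ofList t.walk).sum = S.val := by
    simp only [N, Multiset.map_map]
    exact Multiset.sum_map_singleton _
  have hW : V(G) = (hV.toFinset : Set α) := by simp
  have hcross : ∀ f, cross N f = ∑ e ∈ S, (f (P.src e) + f (P.tgt e)).val := by
    intro f
    simp only [cross, N, Multiset.map_map, Function.comp]
    rfl
  have hmem : ∀ t ∈ N, ∃ e ∈ S,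
      t = ⟨P.src e, P.sOut e + r e, P.tgt e, P.tOut e + r e, [e]⟩ := by
    intro t ht
    obtain ⟨e, he, rfl⟩ := Multiset.mem_map.1 ht
    exact ⟨e, he, rfl⟩
  have hnet : IsNet G (negParity σ) hV.toFinset N := by
    refine ⟨?_, ?_, ?_, ?_, ?_, ?_, ?_⟩
    · intro t ht
      obtain ⟨e, he, rfl⟩ := hmem t ht
      rw [← hW]
      exact ⟨(hlink e he).left_mem, (hlink e he).right_mem⟩
    · intro t ht
      obtain ⟨e, he, rfl⟩ := hmem t ht
      exact .cons (hlink e he) (.nil _)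
    · intro t ht
      obtain ⟨e, he, rfl⟩ := hmem t ht
      have key : ∀ a b c : ZMod 2, 1 + a + b = 1 + (a + c) + (b + c) := by decide
      simp only [FlowEdge.par, List.map_cons, List.map_nil, List.sum_cons, List.sum_nil, add_zero]
      rw [P.par_eq e (hlink e he).edge_mem]
      exact key _ _ _
    · intro f
      rw [hcross]
      exact even_cut_of_eulerian hG S hS _ hW _ _ hlink f
    · intro f hf
      rw [← hW] at hf
      rw [hcross]
      exact le_cut_of_connected hG.1 S hS _ _ hlink hf
    · intro x hx
      rw [← hW] at hx
      rw [← hflow x hx]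
      simp only [N, Multiset.map_map]
      refine Finset.sum_congr rfl fun e he => ?_
      have key : ∀ a b : ZMod 2, pm (a + b) = sgn a (pm b) := by
        intro a b
        rcases zmod2_cases a with rfl | rfl <;> simp only [sgn_zero, sgn_one] <;> revert b <;> decide
      simp only [Function.comp, FlowEdge.exc, Frame.con, hr e he, key]
    · rw [← sum_map_map_neg, hsum]
      exact hodd
  obtain ⟨v, hv, l₁, l₂, l₃, ⟨hw1, hw2, hw3⟩, ⟨ho1, ho2, ho3⟩, hl⟩ :=
    hnet.exists_three_odd (by simpa using hG.1.1)
  rw [hsum] at hl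
  have hvG : v ∈ V(G) := by rw [hW]; exact hv
  have hnd : (l₁ ++ l₂ ++ l₃).Nodup := by
    rw [← Multiset.coe_nodup, ← Multiset.coe_add, ← Multiset.coe_add, hl]
    exact S.nodup
  have hmemS : ∀ e, e ∈ S ↔ e ∈ l₁ ∨ e ∈ l₂ ∨ e ∈ l₃ := by
    intro e
    rw [← Finset.mem_val, ← hl]
    simp
  rw [List.nodup_append', List.nodup_append'] at hnd
  obtain ⟨⟨hn1, hn2, hd12⟩, hn3, hd3⟩ := hnd
  have hd13 : List.Disjoint l₁ l₃ := fun e h1 h3 => hd3 (by simp [h1]) h3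
  have hd23 : List.Disjoint l₂ l₃ := fun e h1 h3 => hd3 (by simp [h1]) h3
  let L : Fin 3 → List β := ![l₁, l₂, l₃]
  have hL : ∀ i, IsWalk G v (L i) v ∧ (L i).Nodup ∧ ((L i).map (negParity σ)).sum = 1 := by
    intro i
    fin_cases i
    exacts [⟨hw1, hn1, ho1⟩, ⟨hw2, hn2, ho2⟩, ⟨hw3, hn3, ho3⟩]
  have hLd : ∀ i j, i ≠ j → List.Disjoint (L i) (L j) := by
    intro i j hij
    fin_cases i <;> fin_cases j <;> first | exact absurd rfl hij | skip
    exacts [hd12, hd13, hd12.symm, hd23, hd13.symm, hd23.symm]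
  refine ⟨fun i => trailGraph G v (L i), fun i => ⟨trailGraph_le hvG _,
    (hL i).1.isEulerian_trailGraph (hL i).2.1, ?_⟩, fun i j hij => ?_, ?_, v, fun i => .inl rfl⟩
  · have hE : E(trailGraph G v (L i)) = (L i).toFinset := by
      ext e
      rw [Finset.mem_coe, List.mem_toFinset]
      exact ⟨fun h => h.1, fun h => ⟨h, (hL i).1.edge_mem e h⟩⟩
    rw [odd_numNegative_iff σ _ hE, List.sum_toFinset _ (hL i).2.1, (hL i).2.2]
  · exact Set.disjoint_left.2 fun e h1 h2 => hLd i j hij h1.1 h2.1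
  · ext e
    rw [Set.mem_iUnion]
    constructor
    · rintro ⟨i, hi⟩
      exact hi.2
    · intro he
      have he' := he
      rw [hS, Finset.mem_coe, hmemS] at he'
      rcases he' with h | h | h
      exacts [⟨0, h, he⟩, ⟨1, h, he⟩, ⟨2, h, he⟩]

end

end SignedGraph

namespace SignedGraph

variable {α β : Type*}

/-! ### Balance -/

/-- Summed over a circuit, the potential counts every vertex twice. -/
lemma isBalanced_of_potential {H : Graph α β} {σ : β → ℤˣ} (hV : V(H).Finite) (hE : E(H).Finite)
    (g : α → ZMod 2) (hg : ∀ e x y, H.IsLink e x y → negParity σ e = g x + g y) :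
    IsBalanced H σ := by
  intro C hC hcirc
  have : Nonempty α := ⟨hcirc.1.1.some⟩
  have hVC := hV.subset hC.vertexSet_mono
  have hEC := hE.subset hC.edgeSet_mono
  obtain ⟨a, b, hab⟩ := exists_ends C
  have hS : E(C) = hEC.toFinset := by simp
  have hW : V(C) = hVC.toFinset := by simp
  have hab' : ∀ e ∈ hEC.toFinset, C.IsLink e (a e) (b e) := fun e he => hab e (by simpa using he)
  rw [sign_eq_one_iff σ _ hS, Finset.sum_congr rfl fun e he => hg e _ _ ((hab' e he).mono hC),
    sum_ends _ hS _ hW a b hab']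
  refine Finset.sum_eq_zero fun v hv => ?_
  rw [hcirc.2 v (by simpa using hv), two_smul, CharTwo.add_self_eq_zero]

section
variable {G : Graph α β}

lemma isWalk_drop_take {l : List β} {v : ℕ → α}
    (hv : ∀ i (hi : i < l.length), G.IsLink l[i] (v i) (v (i + 1))) {i j : ℕ} (hij : i ≤ j)
    (hj : j ≤ l.length) : IsWalk G (v i) ((l.drop i).take (j - i)) (v j) := by
  have h := isWalk_of_index (G := G) (l := (l.drop i).take (j - i)) (v := fun k => v (i + k)) (by
    intro k hk
    have hk' : k < j - i := by
      rw [List.length_take] at hk; omega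
    rw [List.getElem_take, List.getElem_drop]
    exact hv (i + k) (by omega))
  have hlen : ((l.drop i).take (j - i)).length = j - i := by
    rw [List.length_take, List.length_drop]; omega
  rw [hlen] at h
  simpa [hij] using h

/-- At a repeated vertex an odd closed trail splits into two shorter closed trails, one of which is
odd. Without repetition it is a circuit. -/
lemma not_isBalanced_of_odd {σ : β → ℤˣ} {x : α} {l : List β} (h : IsWalk G x l x) (hl : l.Nodup)
    (hodd : (l.map (negParity σ)).sum = 1) : ¬ IsBalanced G σ := by
  classical
  induction hn : l.length using Nat.strong_induction_on generalizing l x with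
  | _ n ih =>
  obtain ⟨v, h0, h1, hv⟩ := h.exists_index
  have hpos : 0 < l.length := by
    rcases l with _ | ⟨e, l⟩
    · simp at hodd
    · simp
  by_cases hrep : ∃ i j, i < j ∧ j < l.length ∧ v i = v j
  · obtain ⟨i, j, hij, hj, hvij⟩ := hrep
    have hw1 := isWalk_drop_take hv hij.le hj.le
    have hw2 := (isWalk_drop_take hv (Nat.zero_le i) (by omega)).append
      (hvij ▸ isWalk_drop_take hv hj.le le_rfl)
    rw [h0, h1] at hw2
    have hsplit : l = (l.drop 0).take (i - 0) ++ ((l.drop i).take (j - i) ++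
        (l.drop j).take (l.length - j)) := by
      rw [List.drop_zero, Nat.sub_zero, List.take_of_length_le (l := l.drop j) (by simp)]
      conv_lhs => rw [← List.take_append_drop i l, ← List.take_append_drop (j - i) (l.drop i),
        List.drop_drop]
      rw [Nat.add_sub_cancel' hij.le]
    have hperm : l.Perm ((l.drop i).take (j - i) ++ ((l.drop 0).take (i - 0) ++
        (l.drop j).take (l.length - j))) := by
      conv_lhs => rw [hsplit]
      rw [← List.append_assoc, ← List.append_assoc]
      exact List.Perm.append_right _ List.perm_append_comm
    have hnd := hperm.nodup_iff.1 hl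
    rw [List.nodup_append'] at hnd
    have hsum := (hperm.map (negParity σ)).sum_eq
    rw [hodd, List.map_append, List.sum_append] at hsum
    have hlen1 : ((l.drop i).take (j - i)).length = j - i := by
      rw [List.length_take, List.length_drop]; omega
    have hlen := hperm.length_eq
    rw [List.length_append, hlen1] at hlen
    rcases zmod2_cases ((((l.drop i).take (j - i)).map (negParity σ)).sum) with h2 | h2
    · rw [h2, zero_add] at hsum
      exact ih _ (by omega) hw2 hnd.2.1 hsum.symm rfl
    · rw [← hvij] at hw1
      exact ih _ (by omega) hw1 hnd.1 h2 rfl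
  · intro hb
    have hx : x ∈ V(G) := by rw [← h0]; exact (hv 0 hpos).left_mem
    have hE : E(trailGraph G x l) = l.toFinset := by
      ext e
      rw [Finset.mem_coe, List.mem_toFinset]
      exact ⟨fun h => h.1, fun he => ⟨he, h.edge_mem e he⟩⟩
    have hVx : ∀ z ∈ V(trailGraph G x l), ∃ i < l.length, v i = z := by
      rintro z (rfl | ⟨e, he, hz⟩)
      · exact ⟨0, hpos, h0⟩
      · obtain ⟨i, hi, rfl⟩ := List.mem_iff_getElem.1 he
        rcases hz.eq_or_eq_of_isLink (hv i hi) with rfl | rfl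
        · exact ⟨i, hi, rfl⟩
        · rcases Nat.lt_or_ge (i + 1) l.length with hlt | hge
          · exact ⟨i + 1, hlt, rfl⟩
          · refine ⟨0, hpos, ?_⟩
            rw [h0, ← h1, show i + 1 = l.length by omega]
    have hcirc : IsCircuit (trailGraph G x l) := by
      refine ⟨(h.isEulerian_trailGraph hl).1, fun z hz => ?_⟩
      obtain ⟨k, hk, rfl⟩ := hVx z hz
      have hval : valency (trailGraph G x l) (v k) =
          ∑ i ∈ Finset.range l.length, ((if v i = v k then 1 else 0) +
            (if v (i + 1) = v k then 1 else 0)) := by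
        rw [valency_eq_sum _ hE, List.sum_toFinset _ hl, Finset.sum_range, ← List.sum_ofFn]
        congr 1
        refine List.ext_getElem (by simp) fun i hi hi' => ?_
        have hi : i < l.length := by simpa using hi
        rw [List.getElem_map, List.getElem_ofFn]
        exact halves_eq (show (trailGraph G x l).IsLink l[i] (v i) (v (i + 1)) from
          ⟨List.getElem_mem _, hv i hi⟩) _
      -- As the walk is closed, a vertex is entered as often as it is left, here once each. A single
      -- loop is included.
      have hshift := (Finset.sum_range_succ' (fun i => if v i = v k then 1 else 0)
        l.length).symm.trans (Finset.sum_range_succ (fun i => if v i = v k then 1 else 0) l.length)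
      rw [h0, h1, add_left_inj] at hshift
      have hone : ∑ i ∈ Finset.range l.length, (if v i = v k then 1 else 0) = 1 := by
        rw [Finset.sum_eq_single_of_mem k (Finset.mem_range.2 hk), if_pos rfl]
        intro i hi hik
        refine if_neg fun hvi => hrep ?_
        rcases lt_or_gt_of_ne hik with hlt | hgt
        · exact ⟨i, k, hlt, hk, hvi⟩
        · exact ⟨k, i, hgt, Finset.mem_range.1 hi, hvi.symm⟩
      rw [hval, Finset.sum_add_distrib, hshift, hone]
    have hs := hb _ (trailGraph_le hx l) hcirc
    rw [sign_eq_one_iff σ _ hE, List.sum_toFinset _ hl, hodd] at hs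
    exact absurd hs (by decide)

/-! ### Closed trails as periodic sequences -/

/-- A closed walk, traversed again and again. The parity `par` changes at negative edges. -/
structure PeriodicWalk (G : Graph α β) (neg : β → ZMod 2) (l : List β) where
  vert : ℕ → α
  par : ℕ → ZMod 2
  edge : ℕ → β
  isLink : ∀ i, G.IsLink (edge i) (vert i) (vert (i + 1))
  par_succ : ∀ i, par (i + 1) = par i + neg (edge i)
  vert_add : ∀ i, vert (i + l.length) = vert i
  par_add : ∀ i, par (i + l.length) = par i + (l.map neg).sum
  pos : 0 < l.length
  edge_eq : ∀ i, edge i = l[i % l.length]'(Nat.mod_lt _ pos)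
  par_eq : ∀ i ≤ l.length, par i = parUpTo neg l i

lemma IsWalk.exists_periodicWalk {x : α} {l : List β} (h : IsWalk G x l x) (neg : β → ZMod 2)
    (hpos : 0 < l.length) : Nonempty (PeriodicWalk G neg l) := by
  obtain ⟨v, h0, h1, hv⟩ := h.exists_index
  let e : ℕ → β := fun i => l[i % l.length]'(Nat.mod_lt _ hpos)
  have he : ∀ i (hi : i < l.length), e i = l[i] := fun i hi => by
    simp only [e, Nat.mod_eq_of_lt hi]
  have hpar : ∀ i ≤ l.length, ∑ j ∈ Finset.range i, neg (e j) = parUpTo neg l i := by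
    intro i
    induction i with
    | zero => intro _; rfl
    | succ i ih =>
      intro hi
      rw [Finset.sum_range_succ, ih (by omega), parUpTo_succ l i (by omega), he i (by omega)]
  refine ⟨⟨fun i => v (i % l.length), fun i => ∑ j ∈ Finset.range i, neg (e j), e, ?_, ?_, ?_, ?_,
    hpos, fun _ => rfl, hpar⟩⟩
  · intro i
    have h2 := hv (i % l.length) (Nat.mod_lt _ hpos)
    have h3 : v (i % l.length + 1) = v ((i + 1) % l.length) := by
      have h4 : (i + 1) % l.length = (i % l.length + 1) % l.length := by rw [Nat.mod_add_mod]
      have hlt := Nat.mod_lt i hpos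
      rcases Nat.lt_or_ge (i % l.length + 1) l.length with h5 | h5
      · rw [h4, Nat.mod_eq_of_lt h5]
      · rw [h4, show i % l.length + 1 = l.length by omega, Nat.mod_self, h0, h1]
    rw [h3] at h2
    exact h2
  · intro i
    exact Finset.sum_range_succ _ _
  · intro i
    simp
  · intro i
    rw [add_comm, Finset.sum_range_add, hpar _ le_rfl, parUpTo_length, add_comm]
    congr 1
    refine Finset.sum_congr rfl fun j _ => ?_
    simp only [e, Nat.add_mod_left]

namespace PeriodicWalk

variable {neg : β → ZMod 2} {l : List β} (T : PeriodicWalk G neg l)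

lemma edge_injective (hl : l.Nodup) {i j : ℕ} (hij : i < j) (hj : j < i + l.length) :
    T.edge i ≠ T.edge j := by
  intro h
  rw [T.edge_eq, T.edge_eq, hl.getElem_inj_iff] at h
  have h1 : l.length ∣ j - i := (Nat.modEq_iff_dvd' hij.le).1 h
  exact absurd (Nat.le_of_dvd (by omega) h1) (by omega)

lemma exists_edge_eq {e : β} (he : e ∈ l) (t : ℕ) (ht : t < l.length) (hne : e ≠ T.edge t) :
    ∃ i, t < i ∧ i < t + l.length ∧ T.edge i = e := by
  obtain ⟨i, hi, rfl⟩ := List.mem_iff_getElem.1 he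
  have h1 : T.edge i = l[i] := by simp only [T.edge_eq, Nat.mod_eq_of_lt hi]
  have h2 : T.edge (i + l.length) = l[i] := by
    simp only [T.edge_eq, Nat.add_mod_right, Nat.mod_eq_of_lt hi]
  rcases lt_trichotomy i t with h | rfl | h
  · exact ⟨i + l.length, by omega, by omega, h2⟩
  · exact absurd h1.symm hne
  · exact ⟨i, h, by omega, h1⟩

/-- If the parity along the walk between two passages through `edge t` is determined by the
vertex, then it is a potential for the other edges. -/
lemma exists_potential (hl : ∀ e ∈ E(G), e ∈ l) {t : ℕ} (ht : t < l.length)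
    (h : ∀ i j, t < i → i < j → j ≤ t + l.length → T.vert i = T.vert j → T.par i = T.par j) :
    ∃ g : α → ZMod 2, (∀ i, t < i → i ≤ t + l.length → g (T.vert i) = T.par i) ∧
      ∀ e x y, G.IsLink e x y → e ≠ T.edge t → neg e = g x + g y := by
  have hg : ∀ z, ∃ c, ∀ i, t < i → i ≤ t + l.length → T.vert i = z → c = T.par i := by
    intro z
    by_cases hz : ∃ i, t < i ∧ i ≤ t + l.length ∧ T.vert i = z
    · obtain ⟨i, h1, h2, rfl⟩ := hz
      refine ⟨T.par i, fun j h3 h4 h5 => ?_⟩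
      rcases lt_trichotomy i j with h6 | rfl | h6
      · exact h i j h1 h6 h4 h5.symm
      · rfl
      · exact (h j i h3 h6 h2 h5).symm
    · push Not at hz
      exact ⟨0, fun i h1 h2 h3 => absurd h3 (hz i h1 h2)⟩
  choose g hg using hg
  refine ⟨g, fun i h1 h2 => hg _ i h1 h2 rfl, fun e x y hxy hne => ?_⟩
  obtain ⟨i, h1, h2, rfl⟩ := T.exists_edge_eq (hl e hxy.edge_mem) t ht hne
  have h3 := hg _ i h1 h2.le rfl
  have h4 := hg _ (i + 1) (by omega) (by omega) rfl
  have key : ∀ a b : ZMod 2, b = a + (a + b) := by decide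
  rcases (T.isLink i).eq_and_eq_or_eq_and_eq hxy with ⟨rfl, rfl⟩ | ⟨rfl, rfl⟩
  · rw [h3, h4, T.par_succ]; exact key _ _
  · rw [h3, h4, T.par_succ, add_comm]; exact key _ _

/-- Between the positions `i` and `j` the walk is a closed trail that avoids `T.edge t`, so it is
even by balance. -/
lemma par_eq_of_isBalanced {σ : β → ℤˣ} {l : List β} (T : PeriodicWalk G (negParity σ) l)
    (hl : l.Nodup) {t : ℕ} (hb : IsBalanced (G.deleteEdges {T.edge t}) σ) {i j : ℕ} (hi : t < i)
    (hij : i < j) (hj : j ≤ t + l.length) (hv : T.vert i = T.vert j) : T.par i = T.par j := by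
  have hlen : ((List.range (j - i)).map fun k => T.edge (i + k)).length = j - i := by simp
  have hw := isWalk_of_index (G := G.deleteEdges {T.edge t})
    (l := (List.range (j - i)).map fun k => T.edge (i + k)) (v := fun k => T.vert (i + k)) (by
      intro k hk
      rw [List.getElem_map, List.getElem_range, Graph.deleteEdges_isLink]
      exact ⟨T.isLink (i + k), (T.edge_injective hl (by omega) (by omega)).symm⟩)
  rw [hlen] at hw
  simp only [add_zero, Nat.add_sub_cancel' hij.le, ← hv] at hw
  have hnd : ((List.range (j - i)).map fun k => T.edge (i + k)).Nodup := by
    refine List.nodup_range.map_on fun a ha b hb hab => ?_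
    rw [List.mem_range] at ha hb
    rcases lt_trichotomy a b with h | h | h
    · exact absurd hab (T.edge_injective hl (by omega) (by omega))
    · exact h
    · exact absurd hab.symm (T.edge_injective hl (by omega) (by omega))
  have hsum : ∀ k, T.par (i + k) =
      T.par i + (((List.range k).map fun k => T.edge (i + k)).map (negParity σ)).sum := by
    intro k
    induction k with
    | zero => simp
    | succ k ih =>
      rw [← add_assoc, T.par_succ, ih, List.range_succ]
      simp [add_assoc]
  by_contra hne
  refine not_isBalanced_of_odd hw hnd ?_ hb
  refine zmod2_ne_zero fun h0 => hne ?_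
  have h1 := hsum (j - i)
  rw [h0, Nat.add_sub_cancel' hij.le, add_zero] at h1
  exact h1.symm

end PeriodicWalk

/-! ### Tightly unbalanced graphs have no flow -/

section
variable {A : Type*} [AddCommGroup A] {neg : β → ZMod 2}

lemma Frame.sum_sgn_con (P : Frame G neg) (S : Finset β) (hS : E(G) = S) (W : Finset α)
    (hW : V(G) = W) (g : α → ZMod 2) (ξ : β → A) :
    ∑ z ∈ W, sgn (g z) (∑ e ∈ S, P.con z e (ξ e)) = ∑ e ∈ S,
      (sgn (g (P.src e) + P.sOut e) (ξ e) + sgn (g (P.tgt e) + P.tOut e) (ξ e)) := by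
  classical
  simp only [map_sum]
  rw [Finset.sum_comm]
  refine Finset.sum_congr rfl fun e he => ?_
  have hl := P.isLink e (by rw [hS]; exact he)
  have h1 : P.src e ∈ W := by rw [← Finset.mem_coe, ← hW]; exact hl.left_mem
  have h2 : P.tgt e ∈ W := by rw [← Finset.mem_coe, ← hW]; exact hl.right_mem
  simp only [Frame.con, map_add, Finset.sum_add_distrib, apply_ite (sgn _), map_zero, sgn_sgn]
  rw [Finset.sum_ite_eq, Finset.sum_ite_eq, if_pos h1, if_pos h2]

/-- A potential `g` of the balanced graph without `e` is inconsistent with `e`, as the whole graph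
is unbalanced. In the sum of Kirchhoff's laws with signs from `g` all other edges cancel, leaving
`±2ξ(e) = 0`. -/
lemma not_isTightlyUnbalanced_of_flow {σ : β → ℤˣ} (P : Frame G (negParity σ))
    (hG : IsEulerian G) (hV : V(G).Finite) (S : Finset β) (hS : E(G) = S)
    (hA : ∀ a : A, a + a = 0 → a = 0) (ξ : β → A) (hξ : ∀ e ∈ S, ξ e ≠ 0)
    (hflow : ∀ z ∈ V(G), ∑ e ∈ S, P.con z e (ξ e) = 0) : ¬ IsTightlyUnbalanced G σ := by
  classical
  rintro ⟨hunb, e, he, hb⟩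
  have hE : E(G).Finite := by rw [hS]; exact S.finite_toSet
  obtain ⟨x, hx⟩ := hG.1.1
  obtain ⟨l, hw, hnd, hmem⟩ := hG.exists_trail hV hE hx
  have hel := (hmem e).2 he
  obtain ⟨T⟩ := hw.exists_periodicWalk (negParity σ) (List.length_pos_of_mem hel)
  obtain ⟨t, ht, rfl⟩ := List.mem_iff_getElem.1 hel
  have hte : T.edge t = l[t] := by simp only [T.edge_eq, Nat.mod_eq_of_lt ht]
  rw [← hte] at hb he
  obtain ⟨g, -, hg⟩ := T.exists_potential (fun e he => (hmem e).2 he) ht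
    fun i j h1 h2 h3 h4 => T.par_eq_of_isBalanced hnd hb h1 h2 h3 h4
  have hlink : ∀ e ∈ S, G.IsLink e (P.src e) (P.tgt e) := fun e he =>
    P.isLink e (by rw [hS]; exact he)
  have heS : T.edge t ∈ S := by rw [← Finset.mem_coe, ← hS]; exact he
  have hsum := P.sum_sgn_con S hS hV.toFinset (by simp) g ξ
  rw [Finset.sum_eq_zero fun z hz => by rw [hflow z (by simpa using hz), map_zero],
    Finset.sum_eq_single_of_mem _ heS] at hsum
  · have hne : negParity σ (T.edge t) ≠ g (P.src (T.edge t)) + g (P.tgt (T.edge t)) := by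
      intro heq
      refine hunb (isBalanced_of_potential hV hE g fun e x y hxy => ?_)
      by_cases h : e = T.edge t
      · subst h
        rcases (hlink _ heS).eq_and_eq_or_eq_and_eq hxy with ⟨h1, h2⟩ | ⟨h1, h2⟩
        · rw [heq, h1, h2]
        · rw [heq, h1, h2, add_comm]
      · exact hg e x y hxy h
    rw [P.par_eq _ he] at hne
    have key : ∀ a b c d : ZMod 2, 1 + a + b ≠ c + d → d + b = c + a := by decide
    rw [key _ _ _ _ hne, ← map_add, eq_comm, sgn_eq_zero] at hsum
    exact hξ _ heS (hA _ hsum)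
  · intro e he hne
    have h1 := hg e _ _ (hlink e he) hne
    rw [P.par_eq e (hlink e he).edge_mem] at h1
    have key : ∀ a b c d : ZMod 2, 1 + a + b = c + d → d + b = 1 + (c + a) := by decide
    rw [key _ _ _ _ h1, sgn_one_add, add_neg_cancel]

end

end

end SignedGraph

namespace SignedGraph

variable {α β : Type*}

/-! ### Coverings of a cycle by arcs -/

/-- The position `i` of a cycle of length `N` lies on the arc from `X.1` to `X.2`. -/
def OnArc (N : ℕ) (X : ℕ × ℕ) (i : ℕ) : Prop :=
  (X.1 ≤ i ∧ i < X.2) ∨ (X.1 ≤ i + N ∧ i + N < X.2)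

/-- A proper arc, normalised such that it starts before `N`. -/
def IsArc (N : ℕ) (X : ℕ × ℕ) : Prop := X.1 < N ∧ X.1 < X.2 ∧ X.2 < X.1 + N

/-- Here `lo` is the start of the copy of an arc, on the unrolled line, that contains `i`. If `Y`
starts no later and `Z` ends no earlier than `X`, then the intervals of `Y` and `Z` overlap at `i`
and together cover that of `X`. -/
lemma onArc_of_between {N i : ℕ} {X Y Z : ℕ × ℕ} {lo : ℕ × ℕ → ℤ} (hi : i < N)
    (hlo : lo = fun X : ℕ × ℕ => if X.1 ≤ i ∧ i < X.2 then (X.1 : ℤ) else X.1 - N)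
    (hX : IsArc N X) (hY : IsArc N Y) (hZ : IsArc N Z) (hXi : OnArc N X i) (hYi : OnArc N Y i)
    (hZi : OnArc N Z i) (hYX : lo Y ≤ lo X)
    (hXZ : lo X + ((X.2 : ℤ) - X.1) ≤ lo Z + ((Z.2 : ℤ) - Z.1)) {t : ℕ} (ht : t < N)
    (hXt : OnArc N X t) : OnArc N Y t ∨ OnArc N Z t := by
  have key : ∀ W : ℕ × ℕ, IsArc N W → OnArc N W i → (lo W ≤ i ∧ i < lo W + ((W.2 : ℤ) - W.1)) ∧
      (OnArc N W t ↔ (lo W ≤ t ∧ t < lo W + ((W.2 : ℤ) - W.1)) ∨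
        (lo W ≤ t + N ∧ t + N < lo W + ((W.2 : ℤ) - W.1)) ∨
        (lo W ≤ (t : ℤ) - N ∧ (t : ℤ) - N < lo W + ((W.2 : ℤ) - W.1))) := by
    rintro ⟨p, q⟩ ⟨h1, h2, h3⟩ h4
    simp only [OnArc, hlo] at h1 h2 h3 h4 ⊢
    split_ifs <;> omega
  obtain ⟨hX1, hX2⟩ := key X hX hXi
  obtain ⟨hY1, hY2⟩ := key Y hY hYi
  obtain ⟨hZ1, hZ2⟩ := key Z hZ hZi
  rw [hX2] at hXt
  rw [hY2, hZ2]
  generalize lo X + ((X.2 : ℤ) - X.1) = hiX, lo Y + ((Y.2 : ℤ) - Y.1) = hiY,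
    lo Z + ((Z.2 : ℤ) - Z.1) = hiZ at *
  generalize lo X = loX, lo Y = loY, lo Z = loZ at *
  clear key hX hY hZ hXi hYi hZi hX2 hY2 hZ2
  omega

open Classical in
/-- In an irredundant family of arcs no position lies on three arcs. -/
lemma card_filter_onArc_le {N : ℕ} {F : Finset (ℕ × ℕ)} (hF : ∀ X ∈ F, IsArc N X)
    (hpriv : ∀ X ∈ F, ∃ t < N, OnArc N X t ∧ ∀ Y ∈ F, Y ≠ X → ¬ OnArc N Y t) {i : ℕ} (hi : i < N) :
    (F.filter fun X => OnArc N X i).card ≤ 2 := by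
  by_contra hlt
  set D := F.filter fun X => OnArc N X i with hD
  have hDF : ∀ X ∈ D, X ∈ F ∧ OnArc N X i := fun X hX => Finset.mem_filter.1 hX
  have hne : D.Nonempty := by
    rw [← Finset.card_pos]; omega
  let lo : ℕ × ℕ → ℤ := fun X => if X.1 ≤ i ∧ i < X.2 then (X.1 : ℤ) else X.1 - N
  obtain ⟨Y, hY, hYmin⟩ := D.exists_min_image lo hne
  obtain ⟨Z, hZ, hZmax⟩ := D.exists_max_image (fun X => lo X + ((X.2 : ℤ) - X.1)) hne
  obtain ⟨X, hX, hXYZ⟩ : ∃ X ∈ D, X ∉ ({Y, Z} : Finset (ℕ × ℕ)) := by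
    by_contra hno
    push Not at hno
    exact hlt ((Finset.card_le_card hno).trans Finset.card_le_two)
  simp only [Finset.mem_insert, Finset.mem_singleton, not_or] at hXYZ
  obtain ⟨t, ht, hXt, hpr⟩ := hpriv X (hDF X hX).1
  rcases onArc_of_between hi rfl (hF X (hDF X hX).1) (hF Y (hDF Y hY).1) (hF Z (hDF Z hZ).1)
    (hDF X hX).2 (hDF Y hY).2 (hDF Z hZ).2 (hYmin X hX) (hZmax X hX) ht hXt with h | h
  · exact hpr Y (hDF Y hY).1 (Ne.symm hXYZ.1) h
  · exact hpr Z (hDF Z hZ).1 (Ne.symm hXYZ.2) h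

open Classical in
lemma exists_irredundant {N : ℕ} (F : Finset (ℕ × ℕ)) (hF : ∀ t < N, ∃ X ∈ F, OnArc N X t) :
    ∃ F' ⊆ F, (∀ t < N, ∃ X ∈ F', OnArc N X t) ∧
      ∀ X ∈ F', ∃ t < N, OnArc N X t ∧ ∀ Y ∈ F', Y ≠ X → ¬ OnArc N Y t := by
  induction hn : F.card using Nat.strong_induction_on generalizing F with
  | _ n ih =>
  by_cases hred : ∃ X ∈ F, ∀ t < N, ∃ Y ∈ F.erase X, OnArc N Y t
  · obtain ⟨X, hX, hc⟩ := hred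
    obtain ⟨F', h1, h2⟩ := ih _ (hn ▸ Finset.card_erase_lt_of_mem hX) (F.erase X) hc rfl
    exact ⟨F', h1.trans (Finset.erase_subset _ _), h2⟩
  · push Not at hred
    refine ⟨F, subset_rfl, hF, fun X hX => ?_⟩
    obtain ⟨t, ht, h⟩ := hred X hX
    obtain ⟨Y, hY, hYt⟩ := hF t ht
    refine ⟨t, ht, ?_, fun Y hY hne => h Y (Finset.mem_erase.2 ⟨hne, hY⟩)⟩
    by_cases hYX : Y = X
    · rwa [← hYX]
    · exact absurd hYt (h Y (Finset.mem_erase.2 ⟨hYX, hY⟩))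

section
variable {A : Type*} [AddCommGroup A]

/-- The values of the flow along an arc of a closed trail of sign `-1`. -/
def arcValue (N : ℕ) (X : ℕ × ℕ) (i : ℕ) (y : A) : A :=
  if X.1 ≤ i ∧ i < X.2 then y else if X.1 ≤ i + N ∧ i + N < X.2 then -y else 0

lemma arcValue_of_not_onArc {N : ℕ} {X : ℕ × ℕ} {i : ℕ} (h : ¬ OnArc N X i) (y : A) :
    arcValue N X i y = 0 := by
  rw [OnArc, not_or] at h
  rw [arcValue, if_neg h.1, if_neg h.2]

lemma arcValue_of_onArc {N : ℕ} {X : ℕ × ℕ} {i : ℕ} (h : OnArc N X i) (y : A) :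
    arcValue N X i y = y ∨ arcValue N X i y = -y := by
  unfold arcValue
  split_ifs with h1 h2
  · exact .inl rfl
  · exact .inr rfl
  · exact absurd h (not_or.2 ⟨h1, h2⟩)

/-- The other arcs, cut open at the position `t`, contribute with the same sign. -/
lemma arcValue_of_not_onArc_base {N t i : ℕ} {X : ℕ × ℕ} (hX : IsArc N X) (ht : t < N)
    (hXt : ¬ OnArc N X t) (hXi : OnArc N X i) (a : A) :
    arcValue N X i (if t < X.1 then a else -a) = if t < i then a else -a := by
  obtain ⟨p, q⟩ := X
  obtain ⟨h1, h2, h3⟩ := hX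
  simp only [OnArc, arcValue] at *
  split_ifs <;> first | rfl | exact neg_neg a | omega

/-- One arc `E` gets `b`. Cut the cycle at a position `t` private to `E`: no other arc crosses `t`,
so signs can be chosen such that all other arcs through a position contribute the same `±a`. With at
most two arcs at a position, the sums are `±a`, `±2a`, `±b` or `±b ± a`. -/
lemma exists_values_ne_zero {N : ℕ} {F : Finset (ℕ × ℕ)} (hpos : 0 < N) (hF : ∀ X ∈ F, IsArc N X)
    (hcov : ∀ t < N, ∃ X ∈ F, OnArc N X t)
    (hpriv : ∀ X ∈ F, ∃ t < N, OnArc N X t ∧ ∀ Y ∈ F, Y ≠ X → ¬ OnArc N Y t)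
    (hA : ∀ x : A, x + x = 0 → x = 0) {a b : A} (ha : a ≠ 0) (hb : b ≠ 0) (hab : b ≠ a)
    (hab' : b ≠ -a) :
    ∃ c : ℕ × ℕ → A, ∀ i < N, ∑ X ∈ F, arcValue N X i (c X) ≠ 0 := by
  classical
  obtain ⟨E, hE, -⟩ := hcov 0 hpos
  obtain ⟨t, ht, hEt, hEpriv⟩ := hpriv E hE
  refine ⟨fun X => if X = E then b else if t < X.1 then a else -a, fun i hi => ?_⟩
  have hcard := card_filter_onArc_le hF hpriv hi
  rw [← Finset.sum_filter_of_ne (p := fun X => OnArc N X i)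
    fun X _ h => by_contra fun hX => h (arcValue_of_not_onArc hX _)]
  set D := F.filter fun X => OnArc N X i with hD
  have hDF : ∀ X ∈ D, X ∈ F ∧ OnArc N X i := fun X hX => Finset.mem_filter.1 hX
  obtain ⟨a', ha', hval⟩ : ∃ a', (a' = a ∨ a' = -a) ∧ ∀ X ∈ D, X ≠ E →
      arcValue N X i (if X = E then b else if t < X.1 then a else -a) = a' := by
    refine ⟨if t < i then a else -a, by split_ifs <;> simp, fun X hX hne => ?_⟩
    rw [if_neg hne]
    exact arcValue_of_not_onArc_base (hF X (hDF X hX).1) ht (hEpriv X (hDF X hX).1 hne)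
      (hDF X hX).2 a
  have ha0 : a' ≠ 0 := by rcases ha' with rfl | rfl <;> simpa using ha
  rw [Finset.sum_congr (s₂ := D) (g := fun X => if X = E then arcValue N E i b else a') rfl]
  · by_cases hED : E ∈ D
    · rw [← Finset.add_sum_erase _ _ hED, if_pos rfl, Finset.sum_congr (g := fun _ => a') rfl
        fun X hX => if_neg (Finset.ne_of_mem_erase hX), Finset.sum_const,
        Finset.card_erase_of_mem hED]
      have hb' := arcValue_of_onArc (hDF E hED).2 b
      obtain h | h : D.card - 1 = 0 ∨ D.card - 1 = 1 := by omega
      · rw [h, zero_smul, add_zero]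
        rcases hb' with h | h <;> simpa [h] using hb
      · rw [h, one_smul, Ne, add_eq_zero_iff_eq_neg]
        intro h
        rcases hb' with h1 | h1 <;> rcases ha' with rfl | rfl <;> rw [h1] at h
        · exact hab' h
        · exact hab (by simpa using h)
        · exact hab (neg_injective h)
        · exact hab' (neg_injective h)
    · rw [Finset.sum_congr (g := fun _ => a') rfl
        fun X hX => if_neg fun h : X = E => hED (h ▸ hX), Finset.sum_const]
      have hpos : 0 < D.card := by
        obtain ⟨X, hX, hXi⟩ := hcov i hi
        exact Finset.card_pos.2 ⟨X, Finset.mem_filter.2 ⟨hX, hXi⟩⟩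
      obtain h | h : D.card = 1 ∨ D.card = 2 := by omega
      · rwa [h, one_smul]
      · rw [h, two_smul]
        exact fun h => ha0 (hA _ h)
  · intro X hX
    by_cases h : X = E
    · simp only [h, if_true]
    · rw [hval X hX h, if_neg h]

end

/-! ### Flows supported by arcs -/

section
variable {A : Type*} [AddCommGroup A] {G : Graph α β} {neg : β → ZMod 2}

lemma signedAt_sum {ι : Type*} (v : ℕ → α) (s : ℕ → ZMod 2) (z : α) (i : ℕ) (F : Finset ι)
    (y : ι → A) : signedAt v s z i (∑ X ∈ F, y X) = ∑ X ∈ F, signedAt v s z i (y X) := by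
  unfold signedAt
  split_ifs
  · exact map_sum _ _ _
  · simp

lemma signedAt_neg (v : ℕ → α) (s : ℕ → ZMod 2) (z : α) (i : ℕ) (y : A) :
    signedAt v s z i (-y) = -signedAt v s z i y := by
  unfold signedAt
  split_ifs <;> simp

lemma signedAt_zero (v : ℕ → α) (s : ℕ → ZMod 2) (z : α) (i : ℕ) :
    signedAt v s z i (0 : A) = 0 := by
  unfold signedAt
  split_ifs <;> simp

/-- Since `s` is antiperiodic, `-y` at `i` acts as `y` at `i + N`. Over two laps the sum telescopes
from `X.1` to `X.2`, where vertex and parity agree. -/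
lemma sum_signedAt_arcValue {N : ℕ} (v : ℕ → α) (s : ℕ → ZMod 2) (hv : ∀ i, v (i + N) = v i)
    (hs : ∀ i, s (i + N) = s i + 1) {X : ℕ × ℕ} (hX : IsArc N X) (hXv : v X.1 = v X.2)
    (hXs : s X.1 = s X.2) (z : α) (y : A) :
    ∑ i ∈ Finset.range N, (signedAt v s z i (arcValue N X i y) -
      signedAt v s z (i + 1) (arcValue N X i y)) = 0 := by
  obtain ⟨p, q⟩ := X
  obtain ⟨h1, h2, h3⟩ := hX
  simp only at h1 h2 h3 hXv hXs
  have hanti : ∀ i, signedAt v s z (i + N) y = -signedAt v s z i y := by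
    intro i
    rw [signedAt, signedAt, hv, hs, add_comm (s i) 1, sgn_one_add]
    split_ifs <;> simp
  have hG : ∀ i ∈ Finset.range N, (signedAt v s z i (arcValue N (p, q) i y) -
      signedAt v s z (i + 1) (arcValue N (p, q) i y)) =
      (if p ≤ i ∧ i < q then signedAt v s z i y - signedAt v s z (i + 1) y else 0) +
      (if p ≤ N + i ∧ N + i < q then
        signedAt v s z (N + i) y - signedAt v s z (N + i + 1) y else 0) := by
    intro i hi
    have h4 : signedAt v s z (N + i + 1) y = -signedAt v s z (i + 1) y := by
      rw [← hanti]; congr 1; omega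
    rw [h4, add_comm N i, hanti]
    simp only [arcValue]
    by_cases h5 : p ≤ i ∧ i < q
    · have h6 : ¬ (p ≤ i + N ∧ i + N < q) := by omega
      rw [if_pos h5, if_pos h5, if_neg h6, add_zero]
    · by_cases h6 : p ≤ i + N ∧ i + N < q
      · rw [if_neg h5, if_neg h5, if_pos h6, if_pos h6, signedAt_neg, signedAt_neg, zero_add]
      · rw [if_neg h5, if_neg h5, if_neg h6, if_neg h6, signedAt_zero, signedAt_zero]
        simp
  have hfil : (Finset.range (N + N)).filter (fun i => p ≤ i ∧ i < q) = Finset.Ico p q := by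
    ext i
    simp only [Finset.mem_filter, Finset.mem_range, Finset.mem_Ico]
    omega
  rw [Finset.sum_congr rfl hG, Finset.sum_add_distrib, ← Finset.sum_range_add
    (fun i => if p ≤ i ∧ i < q then signedAt v s z i y - signedAt v s z (i + 1) y else 0),
    ← Finset.sum_filter, hfil, Finset.sum_Ico_eq_sum_range]
  have := Finset.sum_range_sub' (fun i => signedAt v s z (p + i) y) (q - p)
  simp only [← add_assoc] at this
  rw [this, add_zero, Nat.add_sub_cancel' h2.le]
  rw [signedAt, signedAt, hXv, hXs, sub_self]

/-- If the stretch from `i` to `j` avoiding `t` is an odd closed walk, the complementary stretch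
from `j` to `i + l.length` is even and passes `t`, because the whole trail is odd. The two cases
only shift its start below `l.length`. -/
lemma PeriodicWalk.exists_arc {l : List β} (T : PeriodicWalk G neg l)
    (hodd : (l.map neg).sum = 1) {t : ℕ} (ht : t < l.length)
    (h : ∃ i j, t < i ∧ i < j ∧ j ≤ t + l.length ∧ T.vert i = T.vert j ∧ T.par i ≠ T.par j) :
    ∃ X, IsArc l.length X ∧ OnArc l.length X t ∧ T.vert X.1 = T.vert X.2 ∧
      T.par X.1 = T.par X.2 := by
  obtain ⟨i, j, h1, h2, h3, hv, hp⟩ := h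
  have hp1 : T.par i + 1 = T.par j := by
    have key : ∀ a b : ZMod 2, a ≠ b → a + 1 = b := by decide
    exact key _ _ hp
  rcases Nat.lt_or_ge j l.length with hj | hj
  · refine ⟨(j, i + l.length), ⟨hj, ?_, ?_⟩, .inr ⟨?_, ?_⟩, ?_, ?_⟩
    · change j < i + l.length; omega
    · change i + l.length < j + l.length; omega
    · exact h3
    · change t + l.length < i + l.length; omega
    · change T.vert j = T.vert (i + l.length); rw [T.vert_add, hv]
    · change T.par j = T.par (i + l.length); rw [T.par_add, hodd, hp1]
  · obtain ⟨k, rfl⟩ := Nat.exists_eq_add_of_le' hj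
    refine ⟨(k, i), ⟨?_, ?_, ?_⟩, .inl ⟨?_, ?_⟩, ?_, ?_⟩
    · change k < l.length; omega
    · change k < i; omega
    · change i < k + l.length; omega
    · change k ≤ t; omega
    · exact h1
    · change T.vert k = T.vert i; rw [hv, T.vert_add]
    · change T.par k = T.par i
      rw [T.par_add, hodd] at hp1
      exact (add_right_cancel hp1).symm

lemma Frame.exists_flow_of_not_isTightlyUnbalanced {σ : β → ℤˣ} (P : Frame G (negParity σ))
    (hG : IsEulerian G) (hV : V(G).Finite) (S : Finset β) (hS : E(G) = S)
    (hodd : ∑ e ∈ S, negParity σ e = 1) (hT : ¬ IsTightlyUnbalanced G σ)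
    (hA : ∀ x : A, x + x = 0 → x = 0) {a b : A} (ha : a ≠ 0) (hb : b ≠ 0) (hab : b ≠ a)
    (hab' : b ≠ -a) :
    ∃ ξ : β → A, (∀ e ∈ S, ξ e ≠ 0) ∧ ∀ z, ∑ e ∈ S, P.con z e (ξ e) = 0 := by
  classical
  have hE : E(G).Finite := by rw [hS]; exact S.finite_toSet
  obtain ⟨x, hx⟩ := hG.1.1
  obtain ⟨l, hw, hnd, hmem⟩ := hG.exists_trail hV hE hx
  have hlS := toFinset_eq hS hmem
  have hlodd : (l.map (negParity σ)).sum = 1 := by rw [sum_map_eq_sum hnd hlS, hodd]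
  have hpos : 0 < l.length := by
    rcases l with _ | ⟨e, l⟩
    · simp at hlodd
    · simp
  obtain ⟨T⟩ := hw.exists_periodicWalk (negParity σ) hpos
  have hunb := not_isBalanced_of_odd hw hnd hlodd
  have hte : ∀ t (ht : t < l.length), T.edge t = l[t] := fun t ht => by
    simp only [T.edge_eq, Nat.mod_eq_of_lt ht]
  have harc : ∀ t < l.length, ∃ X, IsArc l.length X ∧ OnArc l.length X t ∧
      T.vert X.1 = T.vert X.2 ∧ T.par X.1 = T.par X.2 := by
    intro t ht
    refine T.exists_arc hlodd ht ?_
    by_contra hno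
    push Not at hno
    -- If no arc passes `t`, the parity depends only on the vertex and is a potential after deletion
    -- of `T.edge t`; the graph would be tightly unbalanced.
    obtain ⟨g, -, hg⟩ := T.exists_potential (fun e he => (hmem e).2 he) ht hno
    refine hT ⟨hunb, T.edge t, ?_, ?_⟩
    · rw [hte t ht, ← hmem]
      exact List.getElem_mem _
    · refine isBalanced_of_potential (hV.subset Graph.deleteEdges_le.vertexSet_mono)
        (hE.subset Graph.deleteEdges_le.edgeSet_mono) g fun e x y hxy => ?_
      rw [Graph.deleteEdges_isLink] at hxy
      exact hg e x y hxy.1 hxy.2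
  choose! X hX1 hX2 hX3 hX4 using harc
  obtain ⟨F, hFX, hcov, hpriv⟩ := exists_irredundant ((Finset.range l.length).image X)
    fun t ht => ⟨X t, Finset.mem_image_of_mem _ (Finset.mem_range.2 ht), hX2 t ht⟩
  have hF : ∀ Y ∈ F, IsArc l.length Y ∧ T.vert Y.1 = T.vert Y.2 ∧ T.par Y.1 = T.par Y.2 := by
    intro Y hY
    obtain ⟨t, ht, rfl⟩ := Finset.mem_image.1 (hFX hY)
    rw [Finset.mem_range] at ht
    exact ⟨hX1 t ht, hX3 t ht, hX4 t ht⟩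
  obtain ⟨c, hc⟩ := exists_values_ne_zero hpos (fun Y hY => (hF Y hY).1) hcov hpriv hA ha hb hab hab'
  obtain ⟨ξ, h1, -, h3⟩ := P.exists_trail_values hnd (v := T.vert)
    (fun i hi => hte i hi ▸ T.isLink i) fun i => ∑ Y ∈ F, arcValue l.length Y i (c Y)
  refine ⟨ξ, fun e he => ?_, fun z => ?_⟩
  · rw [← hlS, List.mem_toFinset] at he
    obtain ⟨i, hi, rfl⟩ := List.mem_iff_getElem.1 he
    rcases h1 i hi with h | h <;> rw [h]
    · exact hc i hi
    · exact neg_ne_zero.2 (hc i hi)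
  · have hpar : ∀ i ≤ l.length, ∀ y : A, signedAt T.vert (parUpTo (negParity σ) l) z i y =
        signedAt T.vert T.par z i y := fun i hi y => by
      simp only [signedAt, T.par_eq i hi]
    rw [← hlS, h3, Finset.sum_congr rfl fun i hi => by
      rw [hpar i (Finset.mem_range.1 hi).le, hpar (i + 1) (Finset.mem_range.1 hi),
        signedAt_sum, signedAt_sum, ← Finset.sum_sub_distrib], Finset.sum_comm]
    refine Finset.sum_eq_zero fun Y hY => ?_
    obtain ⟨h4, h5, h6⟩ := hF Y hY
    exact sum_signedAt_arcValue T.vert T.par T.vert_add (fun i => by rw [T.par_add, hlodd])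
      h4 h5 h6 z (c Y)

end

/-- An abelian group without involutions all of whose elements are `0`, `a` or `-a` has order `3`. -/
lemma exists_ne_of_not_zmod_three {A : Type*} [AddCommGroup A] (hA : ∀ x : A, x + x = 0 → x = 0)
    (h3 : ¬ Nonempty (A ≃+ ZMod 3)) {a : A} (ha : a ≠ 0) : ∃ b : A, b ≠ 0 ∧ b ≠ a ∧ b ≠ -a := by
  by_contra hno
  push Not at hno
  apply h3
  have hne : a ≠ -a := fun h => ha (hA a (by nth_rw 2 [h]; exact add_neg_cancel a))
  have huniv : (Set.univ : Set A) = {0, a, -a} := by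
    ext x
    simp only [Set.mem_univ, Set.mem_insert_iff, Set.mem_singleton_iff, true_iff]
    by_cases h0 : x = 0
    · exact .inl h0
    · by_cases h1 : x = a
      · exact .inr (.inl h1)
      · exact .inr (.inr (hno x h0 h1))
  have hcard : Nat.card A = 3 := by
    rw [← Set.ncard_univ, huniv, Set.ncard_eq_three]
    exact ⟨0, a, -a, ha.symm, by simpa using ha, hne, rfl⟩
  have : Fact (Nat.Prime 3) := ⟨Nat.prime_three⟩
  have hcyc : IsAddCyclic A := isAddCyclic_of_prime_card hcard
  exact ⟨(hcard ▸ zmodAddCyclicAddEquiv hcyc).symm⟩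

end SignedGraph

/-! ### Assembly of the three cases -/

theorem mainTheorem5 {α β A : Type*} (G : Graph α β) (σ : β → ℤˣ)
    (hV : G.vertexSet.Finite) (hE : G.edgeSet.Finite)
    (hG : SignedGraph.IsEulerian G) (D : SignedGraph.Orientation G σ)
    [AddCommGroup A] [Nontrivial A] :
    ((∃ a : A, addOrderOf a = 2) → D.HasNowhereZeroFlow A) ∧
    (Nonempty (A ≃+ ZMod 3) →
      (D.HasNowhereZeroFlow A ↔
        Even (SignedGraph.numNegative G σ) ∨ SignedGraph.IsTriplyOdd G σ)) ∧
    ((¬ ∃ a : A, addOrderOf a = 2) → ¬ Nonempty (A ≃+ ZMod 3) →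
      (D.HasNowhereZeroFlow A ↔ ¬ SignedGraph.IsTightlyUnbalanced G σ)) := by
  classical
  have : Nonempty α := ⟨hG.1.1.some⟩
  have hS : E(G) = hE.toFinset := by simp
  set S := hE.toFinset with hSdef
  obtain ⟨P, hP⟩ := SignedGraph.exists_frame D S hS
  have hmemS : ∀ e, e ∈ S ↔ e ∈ E(G) := fun e => by rw [hS, Finset.mem_coe]
  have hflow : ∀ ξ : β → A, (∀ e ∈ S, ξ e ≠ 0) → (∀ z ∈ V(G), ∑ e ∈ S, P.con z e (ξ e) = 0) →
      D.HasNowhereZeroFlow A := fun ξ h1 h2 =>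
    ⟨fun e => ξ e, (hP A ξ).2 h2, fun e => h1 e ((hmemS e).2 e.2)⟩
  have hpm : ∀ a : A, a ≠ 0 → (∃ ξ : β → A, (∀ e ∈ S, ξ e = a ∨ ξ e = -a) ∧
      ∀ z, ∑ e ∈ S, P.con z e (ξ e) = 0) → D.HasNowhereZeroFlow A := by
    rintro a ha ⟨ξ, h1, h2⟩
    refine hflow ξ (fun e he => ?_) fun z _ => h2 z
    rcases h1 e he with h | h <;> rw [h]
    exacts [ha, neg_ne_zero.2 ha]
  have hback : D.HasNowhereZeroFlow A → ∃ ξ : β → A, (∀ e ∈ S, ξ e ≠ 0) ∧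
      ∀ z ∈ V(G), ∑ e ∈ S, P.con z e (ξ e) = 0 := by
    rintro ⟨ξ, h1, h2⟩
    have h3 : (fun e : E(G) => (fun e => if h : e ∈ E(G) then ξ ⟨e, h⟩ else 0 : β → A) e) = ξ := by
      funext e
      simp
    refine ⟨fun e => if h : e ∈ E(G) then ξ ⟨e, h⟩ else 0, fun e he => ?_, ?_⟩
    · simp only [dif_pos ((hmemS e).1 he)]
      exact h2 _
    · rw [← hP, h3]
      exact h1
  obtain ⟨a, ha⟩ := exists_ne (0 : A)
  refine ⟨?_, ?_, ?_⟩
  · rintro ⟨a, ha⟩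
    have h2 : a + a = 0 := by rw [← two_nsmul, ← ha, addOrderOf_nsmul_eq_zero]
    have h0 : a ≠ 0 := by
      rintro rfl
      simp at ha
    exact hflow (fun _ => a) (fun _ _ => h0) (P.sum_con_of_two_nsmul hG S hS h2)
  · rintro ⟨φ⟩
    constructor
    · intro h
      obtain ⟨ξ, h1, h2⟩ := hback h
      refine or_iff_not_imp_left.2 fun hodd => ?_
      rw [SignedGraph.even_numNegative_iff σ S hS] at hodd
      refine P.isTriplyOdd_of_flow hG hV S hS (SignedGraph.zmod2_ne_zero hodd) (fun e => φ (ξ e))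
        (fun e he => by simpa using h1 e he) fun z hz => ?_
      rw [← map_zero φ, ← h2 z hz, map_sum]
      refine Finset.sum_congr rfl fun e _ => ?_
      have hsgn : ∀ (s : ZMod 2) (y : A), SignedGraph.sgn s (φ y) = φ (SignedGraph.sgn s y) := by
        intro s y
        rcases SignedGraph.zmod2_cases s with rfl | rfl <;>
          simp [SignedGraph.sgn_zero, SignedGraph.sgn_one]
      simp only [SignedGraph.Frame.con, hsgn, map_add, apply_ite φ, map_zero]
    · rintro (h | h)
      · exact hpm a ha (P.exists_flow_of_even hG hV S hS
          ((SignedGraph.even_numNegative_iff σ S hS).1 h) a)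
      · refine hpm a ha (P.exists_flow_of_isTriplyOdd hV S hS h (φ.injective ?_))
        rw [map_nsmul, map_zero, nsmul_eq_mul, show ((3 : ℕ) : ZMod 3) = 0 by decide, zero_mul]
  · intro h2 h3
    have hA : ∀ x : A, x + x = 0 → x = 0 := by
      intro x hx
      by_contra h0
      have : Fact (Nat.Prime 2) := ⟨Nat.prime_two⟩
      exact h2 ⟨x, addOrderOf_eq_prime (by rw [two_nsmul, hx]) h0⟩
    constructor
    · intro h
      obtain ⟨ξ, h4, h5⟩ := hback h
      exact SignedGraph.not_isTightlyUnbalanced_of_flow P hG hV S hS hA ξ h4 h5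
    · intro hT
      -- Even graphs have a flow with values `±a`; arcs and a second value `b` are needed only for
      -- odd ones.
      rcases SignedGraph.zmod2_cases (∑ e ∈ S, SignedGraph.negParity σ e) with h | h
      · exact hpm a ha (P.exists_flow_of_even hG hV S hS h a)
      · obtain ⟨b, hb, hab, hab'⟩ := SignedGraph.exists_ne_of_not_zmod_three hA h3 ha
        obtain ⟨ξ, h4, h5⟩ := P.exists_flow_of_not_isTightlyUnbalanced hG hV S hS h hT hA ha hb hab
          hab'
        exact hflow ξ h4 fun z _ => h5 z
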